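/- **Definitions.** Let $\mathbb{RP}^1$ be the set of lines through the origin in $\mathbb{R}^2$, with its usual topology and the action of $GL_2(\mathbb{R})$. A *multicone* is a nonempty proper subset $\mathcal{C}\subset\mathbb{RP}^1$ that is a finite union of closed (non-degenerate) projective intervals; $\mathcal{C}^o$ denotes its interior and $\partial\mathcal{C}$ its boundary. For $\mathsf{A}\subset GL_2(\mathbb{R})$, a multicone $\mathcal{C}$ is *invariant* for $\mathsf{A}$ if $A\mathcal{C}\subset\mathcal{C}$ for all $A\in\mathsf{A}$, and *strongly invariant* for $\mathsf{A}$ if $A\mathcal{C}\subset\mathcal{C}^o$ for all $A\in\mathsf{A}$. A matrix $A \in GL_2(\mathbb{R})$ is *proximal* if it has two real eigenvalues with unequal absolute values; then $u(A),s(A)\in\mathbb{RP}^1$ denote the eigenspaces of the eigenvalue of larger, respectively smaller, absolute value. It is *parabolic* if it has a single real eigenvalue and this eigenvalue has geometric multiplicity one. It is *conformal* if there is $M\in GL_2(\mathbb{R})$ (a conjugation matrix) such that $|\det(A)|^{-1/2}MAM^{-1}\in O(2)$. A set of matrices is *strongly conformal* if all its elements are conformal with respect to one common conjugation matrix. For a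 set $\mathsf{A}$ of invertible matrices, $\mathcal{S}(\mathsf{A})$ denotes the semigroup of all finite nonempty products of elements of $\mathsf{A}$. Let $$X_u(\mathsf{A})=\overline{\{u(A): A\in\mathcal{S}(\mathsf{A})\text{ proximal}\}},\qquad X_s(\mathsf{A})=\overline{\{s(A): A\in\mathcal{S}(\mathsf{A})\text{ proximal}\}}.$$ A multicone $\mathcal{C}$ is an *unstable multicone* for $\mathsf{A}$ if $\mathcal{S}(\mathsf{A})$ contains at least one proximal element, $\mathcal{C}\cap X_s(\mathsf{A})=\emptyset$, $\partial\mathcal{C}\cap X_u(\mathsf{A})=\emptyset$, and each connected component of $\mathcal{C}$ intersects $X_u(\mathsf{A})$. **Proposition.** Let $\mathsf{A}\subset GL_2(\mathbb{R})$ be such that there is a multicone which is both invariant and unstable for $\mathsf{A}$, and such that $\mathcal{S}(\mathsf{A})$ contains no parabolic element. Let $\mathsf{A}_e$ be the set of all conformal elements of $\mathsf{A}$. Then 1. $\mathsf{A}\setminus\mathsf{A}_e$ is nonempty and contains only proximal elements; 2. $\mathsf{A}_e$ is strongly conformal and $\mathcal{S}(\{|\det(A)|^{-1/2}A : A\in\mathsf{A}_e\})$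 is finite. Moreover, if $\mathsf{A}\setminus\mathsf{A}_e$ is compact, then $\mathsf{A}\setminus\mathsf{A}_e$ has a strongly invariant multicone $\mathcal{C}$ such that $A\mathcal{C}=\mathcal{C}$ for all $A\in\mathsf{A}_e$. -/

import Mathlib

open scoped Pointwise LinearAlgebra.Projectivization

noncomputable section

namespace PlanarMatrix

/-- The real projective line: the set of all lines through the origin in `ℝ²`.  The group
`GL (Fin 2) ℝ` acts on it through Mathlib's action on projectivizations, and on its subsets through
the pointwise action. -/
abbrev RP1 : Type := ℙ ℝ (Fin 2 → ℝ)

/-- The usual (quotient) topology of the projective line. -/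
instance : TopologicalSpace RP1 :=
  inferInstanceAs (TopologicalSpace (Quotient (projectivizationSetoid ℝ (Fin 2 → ℝ))))

theorem angle_ne_zero (θ : ℝ) : (![Real.cos θ, Real.sin θ] : Fin 2 → ℝ) ≠ 0 := by
  intro h
  have h0 : Real.cos θ = 0 := congrFun h 0
  have h1 : Real.sin θ = 0 := congrFun h 1
  have h2 := Real.sin_sq_add_cos_sq θ
  rw [h0, h1] at h2
  norm_num at h2

/-- The line through the origin that makes the angle `θ` with the first coordinate axis. -/
def lineOfAngle (θ : ℝ) : RP1 :=
  Projectivization.mk ℝ ![Real.cos θ, Real.sin θ] (angle_ne_zero θ)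

/-- Closed projective intervals: the lines whose angle runs through a compact interval `[a, b]`
of positive length smaller than `π`. -/
def IsClosedInterval (I : Set RP1) : Prop :=
  ∃ a b : ℝ, a < b ∧ b < a + Real.pi ∧ I = lineOfAngle '' Set.Icc a b

/-- A multicone: a nonempty proper subset of the projective line which is a finite union of
closed projective intervals. -/
def IsMulticone (C : Set RP1) : Prop :=
  (∃ F : Set (Set RP1), F.Finite ∧ (∀ I ∈ F, IsClosedInterval I) ∧ C = ⋃₀ F) ∧
    C.Nonempty ∧ C ≠ Set.univ

/-- `C` is an invariant multicone for `A`. -/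
def IsInvariantMulticone (A : Set (GL (Fin 2) ℝ)) (C : Set RP1) : Prop :=
  IsMulticone C ∧ ∀ g ∈ A, g • C ⊆ C

/-- `C` is a strongly invariant multicone for `A`. -/
def IsStronglyInvariantMulticone (A : Set (GL (Fin 2) ℝ)) (C : Set RP1) : Prop :=
  IsMulticone C ∧ ∀ g ∈ A, g • C ⊆ interior C

/-- The endomorphism of `ℝ²` given by an invertible matrix. -/
def toEnd (g : GL (Fin 2) ℝ) : Module.End ℝ (Fin 2 → ℝ) :=
  Matrix.toLin' (g : Matrix (Fin 2) (Fin 2) ℝ)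

/-- `g` is proximal: it has two real eigenvalues with unequal absolute values. -/
def IsProximal (g : GL (Fin 2) ℝ) : Prop :=
  ∃ a b : ℝ, (toEnd g).HasEigenvalue a ∧ (toEnd g).HasEigenvalue b ∧ |a| ≠ |b|

/-- `g` is parabolic: it has a single real eigenvalue, and this eigenvalue has geometric
multiplicity one. -/
def IsParabolic (g : GL (Fin 2) ℝ) : Prop :=
  ∃ a : ℝ, (∀ b : ℝ, (toEnd g).HasEigenvalue b ↔ b = a) ∧
    Module.finrank ℝ ((toEnd g).eigenspace a) = 1

/-- The matrix `|det g|^(-1/2) g`. -/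
def normalized (g : GL (Fin 2) ℝ) : Matrix (Fin 2) (Fin 2) ℝ :=
  |(g : Matrix (Fin 2) (Fin 2) ℝ).det| ^ (-(1 / 2) : ℝ) • (g : Matrix (Fin 2) (Fin 2) ℝ)

/-- `g` is conformal with conjugation matrix `M`: the matrix `|det g|^(-1/2) M g M⁻¹` is
orthogonal. -/
def IsConformalWith (M g : GL (Fin 2) ℝ) : Prop :=
  normalized (M * g * M⁻¹) ∈ Matrix.orthogonalGroup (Fin 2) ℝ

/-- `g` is conformal. -/
def IsConformal (g : GL (Fin 2) ℝ) : Prop := ∃ M : GL (Fin 2) ℝ, IsConformalWith M g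

/-- `A` is strongly conformal: its elements are conformal with one common conjugation matrix. -/
def IsStronglyConformal (A : Set (GL (Fin 2) ℝ)) : Prop :=
  ∃ M : GL (Fin 2) ℝ, ∀ g ∈ A, IsConformalWith M g

/-- The semigroup of all finite nonempty products of elements of `A`. -/
abbrev semigroup (A : Set (GL (Fin 2) ℝ)) : Subsemigroup (GL (Fin 2) ℝ) :=
  Subsemigroup.closure A

/-- `L = u(g)`: the line `L` is the eigenspace of the eigenvalue of larger absolute value. -/
def IsUnstableDirection (g : GL (Fin 2) ℝ) (L : RP1) : Prop :=
  ∃ a b : ℝ, (toEnd g).HasEigenvalue a ∧ (toEnd g).HasEigenvalue b ∧ |b| < |a| ∧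
    L.submodule = (toEnd g).eigenspace a

/-- `L = s(g)`: the line `L` is the eigenspace of the eigenvalue of smaller absolute value. -/
def IsStableDirection (g : GL (Fin 2) ℝ) (L : RP1) : Prop :=
  ∃ a b : ℝ, (toEnd g).HasEigenvalue a ∧ (toEnd g).HasEigenvalue b ∧ |b| < |a| ∧
    L.submodule = (toEnd g).eigenspace b

/-- `X_u(A)`: the closure of the set of unstable directions of proximal elements of the semigroup
generated by `A`. -/
def unstableSet (A : Set (GL (Fin 2) ℝ)) : Set RP1 :=
  closure {L | ∃ g ∈ semigroup A, IsProximal g ∧ IsUnstableDirection g L}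

/-- `X_s(A)`: the closure of the set of stable directions of proximal elements of the semigroup
generated by `A`. -/
def stableSet (A : Set (GL (Fin 2) ℝ)) : Set RP1 :=
  closure {L | ∃ g ∈ semigroup A, IsProximal g ∧ IsStableDirection g L}

/-- `C` is an unstable multicone for `A`. -/
def IsUnstableMulticone (A : Set (GL (Fin 2) ℝ)) (C : Set RP1) : Prop :=
  IsMulticone C ∧ (∃ g ∈ semigroup A, IsProximal g) ∧
    C ∩ stableSet A = ∅ ∧
    frontier C ∩ unstableSet A = ∅ ∧
    ∀ L ∈ C, (connectedComponentIn C L ∩ unstableSet A).Nonempty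

/-- `A_e`: the set of all conformal elements of `A`. -/
def conformalPart (A : Set (GL (Fin 2) ℝ)) : Set (GL (Fin 2) ℝ) := {g ∈ A | IsConformal g}

end PlanarMatrix

end

open PlanarMatrix

/-! Fix an invariant unstable multicone `C`. Its frontier is finite and has at least two points, and
the proof lets the semigroup act on these points. The properties of a semigroup element that matter
are collected in `IsTame`.

The central observation is `IsTame.smul_eq`. Suppose that a tame `t` fixes a frontier point. The
absence of parabolic elements gives a second independent eigenvector. Eigenvalues of different
modulus would put an unstable direction on the frontier or a stable direction in `C`, so the moduli
agree, `t ^ 2` is scalar and `t • C = C`.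

Tameness only depends on the action on lines, so it passes to `scaledMonoid`, where determinants can
be normalized to `±1`. The normalized elements mapping `C` onto itself form a group, which is finite
because it permutes the frontier (`stabilizerGroup_finite`). A finite group preserves an averaged
inner product, hence is strongly conformal. Conversely, a conformal matrix that maps `C` into itself
maps it onto itself, by recurrence in the compact group `O(2)` (`IsConformal.smul_eq`). Thus the
conformal elements of `A` are exactly those with `g • C = C`. They cannot exhaust `A`, since a
proximal tame matrix never maps `C` onto itself. A nonconformal element of `A` is proximal because
every matrix is proximal, parabolic or conformal.

For the strongly invariant multicone, consider products of elements that do not map `C` onto itself.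
If arbitrarily long ones kept reaching the frontier, finiteness would yield a cycle, that is, a
product that fixes a frontier point but does not preserve `C`, which is impossible. Hence long
products map `C` into its interior (`exists_imageIterate_subset_interior`). Compactness allows `C`
to be enlarged to a set mapped into its own interior in one step (`exists_strongly_invariant`), and
the union of its images under the finite group is the required multicone. -/

noncomputable section

namespace PlanarMatrix

open Projectivization Topology Filter

/-! ### Plane vectors and the action on lines -/

/-- The determinant of two plane vectors. -/
def cross (v w : Fin 2 → ℝ) : ℝ := v 0 * w 1 - v 1 * w 0

theorem ne_zero_left_of_cross {v w : Fin 2 → ℝ} (h : cross v w ≠ 0) : v ≠ 0 := by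
  rintro rfl; simp [cross] at h

theorem ne_zero_right_of_cross {v w : Fin 2 → ℝ} (h : cross v w ≠ 0) : w ≠ 0 := by
  rintro rfl; simp [cross] at h

theorem cross_self (v : Fin 2 → ℝ) : cross v v = 0 := by simp [cross]; ring

theorem cross_swap (v w : Fin 2 → ℝ) : cross w v = -cross v w := by simp [cross]; ring

theorem cross_smul_left (c : ℝ) (v w : Fin 2 → ℝ) : cross (c • v) w = c * cross v w := by
  simp [cross]; ring

theorem cross_smul_right (c : ℝ) (v w : Fin 2 → ℝ) : cross v (c • w) = c * cross v w := by
  simp [cross]; ring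

/-- Cramer's rule cleared of denominators. It reduces identities between linear maps to their values
on two independent vectors. -/
theorem cross_expand (v w u : Fin 2 → ℝ) :
    cross v w • u = cross u w • v + cross v u • w := by
  ext i; fin_cases i <;> simp [cross] <;> ring

theorem continuous_cross {Y : Type*} [TopologicalSpace Y] {f g : Y → Fin 2 → ℝ}
    (hf : Continuous f) (hg : Continuous g) : Continuous fun y => cross (f y) (g y) := by
  have hf' := continuous_pi_iff.1 hf
  have hg' := continuous_pi_iff.1 hg
  exact ((hf' 0).mul (hg' 1)).sub ((hf' 1).mul (hg' 0))

theorem exists_smul_of_cross_eq_zero {v w : Fin 2 → ℝ} (hw : w ≠ 0) (h : cross v w = 0) :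
    ∃ a : ℝ, a • w = v := by
  simp only [cross] at h
  by_cases h0 : w 0 = 0
  · have h1 : w 1 ≠ 0 := fun h1 => hw (by ext i; fin_cases i <;> simp [h0, h1])
    have hv : v 0 = 0 := by
      rw [h0, mul_zero, sub_zero] at h
      exact (mul_eq_zero.1 h).resolve_right h1
    refine ⟨v 1 / w 1, ?_⟩
    ext i; fin_cases i
    · simp [h0, hv]
    · simp [h1]
  · refine ⟨v 0 / w 0, ?_⟩
    ext i; fin_cases i
    · simp [h0]
    · simp; field_simp; linarith

theorem mk_eq_mk_iff_cross {v w : Fin 2 → ℝ} (hv : v ≠ 0) (hw : w ≠ 0) :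
    mk ℝ v hv = mk ℝ w hw ↔ cross v w = 0 := by
  rw [mk_eq_mk_iff']
  constructor
  · rintro ⟨a, rfl⟩; rw [cross_smul_left, cross_self, mul_zero]
  · exact exists_smul_of_cross_eq_zero hw

theorem exists_eq_mk (L : RP1) : ∃ (u : Fin 2 → ℝ) (hu : u ≠ 0), L = mk ℝ u hu :=
  ⟨L.rep, L.rep_nonzero, L.mk_rep.symm⟩

theorem mk_smul_eq {v : Fin 2 → ℝ} (hv : v ≠ 0) {c : ℝ} (h : c • v ≠ 0) :
    mk ℝ (c • v) h = mk ℝ v hv := by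
  rw [mk_eq_mk_iff_cross, cross_smul_left, cross_self, mul_zero]

theorem gl_smul_eq (g : GL (Fin 2) ℝ) (v : Fin 2 → ℝ) :
    g • v = (g : Matrix (Fin 2) (Fin 2) ℝ).mulVec v := rfl

theorem gl_smul_smul (g : GL (Fin 2) ℝ) (c : ℝ) (v : Fin 2 → ℝ) : g • (c • v) = c • (g • v) := by
  simp only [gl_smul_eq, Matrix.mulVec_smul]

theorem cross_gl_smul (g : GL (Fin 2) ℝ) (v w : Fin 2 → ℝ) :
    cross (g • v) (g • w) = (g : Matrix (Fin 2) (Fin 2) ℝ).det * cross v w := by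
  simp only [gl_smul_eq, cross, Matrix.mulVec, dotProduct, Fin.sum_univ_two, Matrix.det_fin_two]
  ring

theorem det_gl_ne_zero (g : GL (Fin 2) ℝ) : (g : Matrix (Fin 2) (Fin 2) ℝ).det ≠ 0 :=
  (Matrix.GeneralLinearGroup.det g).ne_zero

/-! ### Topology of the projective line -/

/-- The saturation of an open set is the union of its rescalings. Openness is what makes the
Hausdorff criterion and products of quotient maps available. -/
theorem isOpenQuotientMap_mk : IsOpenQuotientMap (mk' ℝ : {v : Fin 2 → ℝ // v ≠ 0} → RP1) := by
  have hq : IsQuotientMap (mk' ℝ : {v : Fin 2 → ℝ // v ≠ 0} → RP1) := isQuotientMap_quot_mk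
  refine ⟨hq.surjective, hq.continuous, fun U hU => ?_⟩
  rw [← hq.isOpen_preimage]
  have : (mk' ℝ : {v : Fin 2 → ℝ // v ≠ 0} → RP1) ⁻¹' (mk' ℝ '' U) =
      ⋃ c : ℝˣ, (fun v : {v : Fin 2 → ℝ // v ≠ 0} =>
        (⟨c • (v : Fin 2 → ℝ), (smul_ne_zero_iff_ne c).2 v.2⟩ :
          {v : Fin 2 → ℝ // v ≠ 0})) ⁻¹' U := by
    ext v
    simp only [Set.mem_preimage, Set.mem_image, Set.mem_iUnion, mk'_eq_mk]
    constructor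
    · rintro ⟨w, hw, h⟩
      obtain ⟨a, ha⟩ := (mk_eq_mk_iff ℝ _ _ _ _).1 h
      refine ⟨a, ?_⟩
      convert hw
    · rintro ⟨c, hc⟩
      exact ⟨_, hc, (mk_eq_mk_iff ℝ _ _ _ _).2 ⟨c, rfl⟩⟩
  rw [this]
  refine isOpen_iUnion fun c => hU.preimage ?_
  exact Continuous.subtype_mk (continuous_subtype_val.const_smul c) _

theorem continuous_mk_comp {Y : Type*} [TopologicalSpace Y] {f : Y → Fin 2 → ℝ}
    (hf : Continuous f) (h0 : ∀ y, f y ≠ 0) : Continuous fun y => mk ℝ (f y) (h0 y) :=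
  isOpenQuotientMap_mk.continuous.comp (hf.subtype_mk h0)

theorem isClosed_iff_mk {U : Set RP1} :
    IsClosed U ↔ IsClosed {v : {v : Fin 2 → ℝ // v ≠ 0} | mk ℝ v.1 v.2 ∈ U} :=
  (isOpenQuotientMap_mk.isQuotientMap.isClosed_preimage (s := U)).symm

instance : T2Space RP1 := by
  rw [t2Space_iff_of_isOpenQuotientMap isOpenQuotientMap_mk]
  have : {q : {v : Fin 2 → ℝ // v ≠ 0} × {v : Fin 2 → ℝ // v ≠ 0} | mk' ℝ q.1 = mk' ℝ q.2} =
      {q | cross q.1.1 q.2.1 = 0} := by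
    ext ⟨v, w⟩
    exact mk_eq_mk_iff_cross v.2 w.2
  rw [this]
  exact isClosed_eq (continuous_cross (continuous_subtype_val.comp continuous_fst)
    (continuous_subtype_val.comp continuous_snd)) continuous_const

instance : ContinuousSMul (GL (Fin 2) ℝ) RP1 := by
  have hq := (IsOpenQuotientMap.id (X := GL (Fin 2) ℝ)).prodMap isOpenQuotientMap_mk
  refine ⟨hq.isQuotientMap.continuous_iff.2 ?_⟩
  have : ((fun p : GL (Fin 2) ℝ × RP1 => p.1 • p.2) ∘ Prod.map id (mk' ℝ)) =
      fun p : GL (Fin 2) ℝ × {v : Fin 2 → ℝ // v ≠ 0} =>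
        mk ℝ (p.1 • p.2.1) ((smul_ne_zero_iff_ne p.1).2 p.2.2) := rfl
  rw [this]
  refine continuous_mk_comp ?_ _
  simp only [gl_smul_eq]
  exact (Units.continuous_val.comp continuous_fst).matrix_mulVec
    (continuous_subtype_val.comp continuous_snd)

theorem continuous_lineOfAngle : Continuous lineOfAngle := by
  refine continuous_mk_comp (f := fun θ => ![Real.cos θ, Real.sin θ]) ?_ _
  refine continuous_pi fun i => ?_
  fin_cases i
  · exact Real.continuous_cos
  · exact Real.continuous_sin

theorem cross_angle (a b : ℝ) :
    cross ![Real.cos a, Real.sin a] ![Real.cos b, Real.sin b] = Real.sin (b - a) := by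
  simp [cross, Real.sin_sub]; ring

theorem exists_angle_smul {v : Fin 2 → ℝ} (hv : v ≠ 0) (a : ℝ) :
    ∃ θ ∈ Set.Ico a (a + Real.pi), ∃ r : ℝ, r ≠ 0 ∧ v = r • ![Real.cos θ, Real.sin θ] := by
  obtain ⟨θ, r, hr, h⟩ : ∃ θ r : ℝ, r ≠ 0 ∧ v = r • ![Real.cos θ, Real.sin θ] := by
    set z : ℂ := ⟨v 0, v 1⟩
    have hz : z ≠ 0 := by
      intro h
      apply hv
      ext i; fin_cases i
      · exact congrArg Complex.re h
      · exact congrArg Complex.im h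
    refine ⟨z.arg, ‖z‖, by simpa using hz, ?_⟩
    ext i; fin_cases i
    · exact (Complex.norm_mul_cos_arg z).symm
    · exact (Complex.norm_mul_sin_arg z).symm
  refine ⟨toIcoMod Real.pi_pos a θ, toIcoMod_mem_Ico _ _ _, ?_⟩
  have h1 := toIcoMod_add_toIcoDiv_zsmul Real.pi_pos a θ
  set n := toIcoDiv Real.pi_pos a θ
  set θ' := toIcoMod Real.pi_pos a θ
  refine ⟨r * (-1) ^ n, mul_ne_zero hr (zpow_ne_zero _ (by norm_num)), ?_⟩
  rw [h, ← h1, zsmul_eq_mul]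
  ext i; fin_cases i
  · simp [Real.cos_add_int_mul_pi, mul_assoc]
  · simp [Real.sin_add_int_mul_pi, mul_assoc]

theorem lineOfAngle_surjOn (a : ℝ) (L : RP1) :
    ∃ θ ∈ Set.Ico a (a + Real.pi), lineOfAngle θ = L := by
  obtain ⟨v, hv, rfl⟩ := exists_eq_mk L
  obtain ⟨θ, hθ, r, hr, rfl⟩ := exists_angle_smul hv a
  exact ⟨θ, hθ, (mk_smul_eq _ _).symm⟩

theorem lineOfAngle_surjective : Function.Surjective lineOfAngle := fun L =>
  let ⟨θ, _, h⟩ := lineOfAngle_surjOn 0 L; ⟨θ, h⟩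

instance : CompactSpace RP1 := by
  constructor
  have : (Set.univ : Set RP1) = lineOfAngle '' Set.Icc 0 (0 + Real.pi) := by
    refine (Set.eq_univ_of_forall fun L => ?_).symm
    obtain ⟨θ, hθ, h⟩ := lineOfAngle_surjOn 0 L
    exact ⟨θ, Set.Ico_subset_Icc_self hθ, h⟩
  rw [this]
  exact isCompact_Icc.image continuous_lineOfAngle

instance : PreconnectedSpace RP1 := by
  constructor
  rw [← lineOfAngle_surjective.range_eq]
  exact isPreconnected_range continuous_lineOfAngle

/-- The removal of a point does not disconnect the projective line. -/
theorem isPreconnected_compl_singleton (p : RP1) : IsPreconnected ({p}ᶜ : Set RP1) := by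
  obtain ⟨a, rfl⟩ := lineOfAngle_surjective p
  have : ({lineOfAngle a}ᶜ : Set RP1) = lineOfAngle '' Set.Ioo a (a + Real.pi) := by
    ext L
    constructor
    · intro hL
      obtain ⟨θ, hθ, rfl⟩ := lineOfAngle_surjOn a L
      refine ⟨θ, ⟨lt_of_le_of_ne hθ.1 ?_, hθ.2⟩, rfl⟩
      rintro rfl
      exact hL rfl
    · rintro ⟨θ, hθ, rfl⟩ h
      have h : lineOfAngle θ = lineOfAngle a := h
      rw [lineOfAngle, lineOfAngle, mk_eq_mk_iff_cross, cross_angle] at h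
      have := Real.sin_pos_of_pos_of_lt_pi (x := θ - a) (by linarith [hθ.1]) (by linarith [hθ.2])
      rw [← neg_sub, Real.sin_neg] at h
      linarith
  rw [this]
  exact isPreconnected_Ioo.image _ continuous_lineOfAngle.continuousOn

/-! ### Closed intervals as sectors -/

/-- The lines in the double cone `{u | 0 ≤ cross v u * cross u w}`. -/
def sector (v w : Fin 2 → ℝ) : Set RP1 := {L | 0 ≤ cross v L.rep * cross L.rep w}

/-- The product is quadratic in `u`, so its sign does not depend on the representative of the line.
-/
theorem cross_mul_cross_rep (v w : Fin 2 → ℝ) {u : Fin 2 → ℝ} (hu : u ≠ 0) :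
    ∃ c : ℝ, 0 < c ∧
      cross v (mk ℝ u hu).rep * cross (mk ℝ u hu).rep w = c * (cross v u * cross u w) := by
  obtain ⟨a, ha⟩ := exists_smul_eq_mk_rep ℝ u hu
  refine ⟨(a : ℝ) ^ 2, sq_pos_of_ne_zero a.ne_zero, ?_⟩
  rw [← ha, Units.smul_def, cross_smul_left, cross_smul_right]
  ring

theorem mk_mem_sector {v w u : Fin 2 → ℝ} (hu : u ≠ 0) :
    mk ℝ u hu ∈ sector v w ↔ 0 ≤ cross v u * cross u w := by
  obtain ⟨c, hc, h⟩ := cross_mul_cross_rep v w hu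
  rw [sector, Set.mem_ofPred_eq, h, mul_nonneg_iff_of_pos_left hc]

theorem isClosed_sector (v w : Fin 2 → ℝ) : IsClosed (sector v w) := by
  rw [isClosed_iff_mk]
  simp only [mk_mem_sector]
  refine isClosed_le continuous_const
    ((continuous_cross continuous_const continuous_subtype_val).mul
    (continuous_cross continuous_subtype_val continuous_const))

theorem mk_mem_interior_sector {v w u : Fin 2 → ℝ} (hu : u ≠ 0) (h : 0 < cross v u * cross u w) :
    mk ℝ u hu ∈ interior (sector v w) := by
  refine mem_interior.2 ⟨mk' ℝ '' {u | 0 < cross v u.1 * cross u.1 w}, ?_, ?_, ⟨⟨u, hu⟩, h, rfl⟩⟩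
  · rintro _ ⟨u, hu, rfl⟩
    exact (mk_mem_sector u.2).2 (le_of_lt hu)
  · apply isOpenQuotientMap_mk.isOpenMap
    refine isOpen_lt continuous_const
      ((continuous_cross continuous_const continuous_subtype_val).mul
      (continuous_cross continuous_subtype_val continuous_const))

theorem frontier_sector_finite {v w : Fin 2 → ℝ} (hvw : cross v w ≠ 0) :
    (frontier (sector v w)).Finite := by
  refine Set.Finite.subset (Set.toFinite {mk ℝ v (ne_zero_left_of_cross hvw),
    mk ℝ w (ne_zero_right_of_cross hvw)}) ?_
  intro L hL
  rw [(isClosed_sector v w).frontier_eq] at hL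
  obtain ⟨u, hu, rfl⟩ := exists_eq_mk L
  have h1 := (mk_mem_sector hu).1 hL.1
  have h2 := fun h => hL.2 (mk_mem_interior_sector hu h)
  rcases mul_eq_zero.1 (le_antisymm (not_lt.1 h2) h1) with h | h
  · left
    rw [mk_eq_mk_iff_cross, cross_swap, h, neg_zero]
  · right
    exact (mk_eq_mk_iff_cross _ _).2 h

/-- Each cross product is multiplied by the determinant, so the defining product is multiplied by
its square and the orientation of `g` plays no role. -/
theorem smul_sector (g : GL (Fin 2) ℝ) (v w : Fin 2 → ℝ) :
    g • sector v w = sector (g • v) (g • w) := by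
  have key : ∀ (g : GL (Fin 2) ℝ) (v w : Fin 2 → ℝ), g • sector v w ⊆ sector (g • v) (g • w) := by
    rintro g v w _ ⟨L, hL, rfl⟩
    obtain ⟨u, hu, rfl⟩ := exists_eq_mk L
    refine (mk_mem_sector ((smul_ne_zero_iff_ne g).2 hu)).2 ?_
    rw [cross_gl_smul, cross_gl_smul]
    have h := (mk_mem_sector hu).1 hL
    nlinarith [mul_nonneg (sq_nonneg (g : Matrix (Fin 2) (Fin 2) ℝ).det) h]
  refine (key g v w).antisymm ?_
  rw [Set.subset_smul_set_iff]
  have h := key g⁻¹ (g • v) (g • w)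
  rwa [inv_smul_smul, inv_smul_smul] at h

theorem image_lineOfAngle_Icc {a b : ℝ} (hab : a < b) (hb : b < a + Real.pi) :
    lineOfAngle '' Set.Icc a b =
      sector ![Real.cos a, Real.sin a] ![Real.cos b, Real.sin b] := by
  ext L
  constructor
  · rintro ⟨θ, hθ, rfl⟩
    refine (mk_mem_sector _).2 ?_
    rw [cross_angle, cross_angle]
    exact mul_nonneg (Real.sin_nonneg_of_nonneg_of_le_pi (by linarith [hθ.1]) (by linarith [hθ.2]))
      (Real.sin_nonneg_of_nonneg_of_le_pi (by linarith [hθ.2]) (by linarith [hθ.1]))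
  · intro hL
    obtain ⟨θ, hθ, rfl⟩ := lineOfAngle_surjOn a L
    refine ⟨θ, ⟨hθ.1, ?_⟩, rfl⟩
    by_contra! hbθ
    have h := (mk_mem_sector _).1 hL
    rw [cross_angle, cross_angle] at h
    have h1 := Real.sin_pos_of_pos_of_lt_pi (x := θ - a) (by linarith) (by linarith [hθ.2])
    have h2 := Real.sin_pos_of_pos_of_lt_pi (x := θ - b) (by linarith) (by linarith [hθ.2])
    rw [← neg_sub θ b, Real.sin_neg] at h
    nlinarith [mul_pos h1 h2]

/-- Sectors describe intervals without angles, in a form that is visibly equivariant under the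
linear group. -/
theorem isClosedInterval_iff {I : Set RP1} :
    IsClosedInterval I ↔ ∃ v w, cross v w ≠ 0 ∧ I = sector v w := by
  constructor
  · rintro ⟨a, b, hab, hb, rfl⟩
    refine ⟨_, _, ?_, image_lineOfAngle_Icc hab hb⟩
    rw [cross_angle]
    exact (Real.sin_pos_of_pos_of_lt_pi (by linarith) (by linarith)).ne'
  · rintro ⟨v, w, hvw, rfl⟩
    obtain ⟨a, -, r, hr, rfl⟩ := exists_angle_smul (ne_zero_left_of_cross hvw) 0
    obtain ⟨b, hb, s, hs, rfl⟩ := exists_angle_smul (ne_zero_right_of_cross hvw) a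
    have hab : a < b := by
      refine lt_of_le_of_ne hb.1 ?_
      rintro rfl
      rw [cross_smul_left, cross_smul_right, cross_self, mul_zero, mul_zero] at hvw
      exact hvw rfl
    rcases (mul_ne_zero hr hs).lt_or_gt with h | h
    -- Scalars of opposite sign select the complementary arc, which runs from `b` to `a + π`.
    · refine ⟨b, a + Real.pi, hb.2, by linarith, ?_⟩
      rw [image_lineOfAngle_Icc hb.2 (by linarith)]
      ext L
      obtain ⟨u, hu, rfl⟩ := exists_eq_mk L
      rw [mk_mem_sector, mk_mem_sector, cross_smul_left, cross_smul_right]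
      have e : (![Real.cos (a + Real.pi), Real.sin (a + Real.pi)] : Fin 2 → ℝ) =
          (-1 : ℝ) • ![Real.cos a, Real.sin a] := by
        ext i; fin_cases i <;> simp
      rw [e, cross_smul_right, cross_swap u ![Real.cos b, _],
        cross_swap ![Real.cos a, _] u, mul_mul_mul_comm]
      constructor
      · intro h'
        by_contra! h''
        have := mul_neg_of_neg_of_pos h (show 0 < cross ![Real.cos a, Real.sin a] u *
          cross u ![Real.cos b, Real.sin b] by linarith)
        linarith
      · intro h'
        refine mul_nonneg_of_nonpos_of_nonpos h.le ?_
        linarith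
    · refine ⟨a, b, hab, hb.2, ?_⟩
      rw [image_lineOfAngle_Icc hab hb.2]
      ext L
      obtain ⟨u, hu, rfl⟩ := exists_eq_mk L
      rw [mk_mem_sector, mk_mem_sector, cross_smul_left, cross_smul_right,
        mul_mul_mul_comm, mul_nonneg_iff_of_pos_left h]

theorem IsClosedInterval.smul {I : Set RP1} (hI : IsClosedInterval I) (g : GL (Fin 2) ℝ) :
    IsClosedInterval (g • I) := by
  obtain ⟨v, w, h, rfl⟩ := isClosedInterval_iff.1 hI
  refine isClosedInterval_iff.2 ⟨g • v, g • w, ?_, smul_sector g v w⟩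
  rw [cross_gl_smul]
  exact mul_ne_zero (det_gl_ne_zero g) h

/-! ### Finite unions of intervals and multicones -/

/-- Finite unions of closed projective intervals. -/
def IsIntervalUnion (C : Set RP1) : Prop :=
  ∃ F : Set (Set RP1), F.Finite ∧ (∀ I ∈ F, IsClosedInterval I) ∧ C = ⋃₀ F

theorem isIntervalUnion_empty : IsIntervalUnion ∅ :=
  ⟨∅, Set.finite_empty, by simp, by simp⟩

theorem IsClosedInterval.isIntervalUnion {I : Set RP1} (h : IsClosedInterval I) :
    IsIntervalUnion I :=
  ⟨{I}, Set.finite_singleton I, by simpa using h, by simp⟩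

theorem IsIntervalUnion.union {C D : Set RP1} (hC : IsIntervalUnion C) (hD : IsIntervalUnion D) :
    IsIntervalUnion (C ∪ D) := by
  obtain ⟨F, hF, hFI, rfl⟩ := hC
  obtain ⟨G, hG, hGI, rfl⟩ := hD
  exact ⟨F ∪ G, hF.union hG, fun I hI => hI.elim (hFI I) (hGI I), (Set.sUnion_union F G).symm⟩

theorem isIntervalUnion_biUnion {ι : Type*} {s : Set ι} (hs : s.Finite) {C : ι → Set RP1}
    (h : ∀ i ∈ s, IsIntervalUnion (C i)) : IsIntervalUnion (⋃ i ∈ s, C i) := by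
  induction s, hs using Set.Finite.induction_on with
  | empty => simpa using isIntervalUnion_empty
  | insert _ _ ih =>
    rw [Set.biUnion_insert]
    exact (h _ (Set.mem_insert _ _)).union (ih fun i hi => h i (Set.mem_insert_of_mem _ hi))

theorem IsIntervalUnion.smul {C : Set RP1} (hC : IsIntervalUnion C) (g : GL (Fin 2) ℝ) :
    IsIntervalUnion (g • C) := by
  obtain ⟨F, hF, hFI, rfl⟩ := hC
  have : g • ⋃₀ F = ⋃ I ∈ F, g • I := by
    rw [Set.sUnion_eq_biUnion, Set.smul_set_iUnion₂]
  rw [this]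
  exact isIntervalUnion_biUnion hF fun I hI => ((hFI I hI).smul g).isIntervalUnion

theorem IsClosedInterval.isClosed {I : Set RP1} (h : IsClosedInterval I) : IsClosed I := by
  obtain ⟨v, w, -, rfl⟩ := isClosedInterval_iff.1 h
  exact isClosed_sector v w

theorem IsClosedInterval.interior_nonempty {I : Set RP1} (h : IsClosedInterval I) :
    (interior I).Nonempty := by
  obtain ⟨v, w, hvw, rfl⟩ := isClosedInterval_iff.1 h
  have h2 : cross (v + (1 : ℝ) • w) w = cross v w := by simp [cross]; ring
  have h3 : cross v (v + (1 : ℝ) • w) = cross v w := by simp [cross]; ring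
  refine ⟨mk ℝ (v + (1 : ℝ) • w) (ne_zero_left_of_cross (h2 ▸ hvw)), ?_⟩
  apply mk_mem_interior_sector
  rw [h2, h3]
  exact mul_self_pos.2 hvw

theorem IsIntervalUnion.isClosed {C : Set RP1} (h : IsIntervalUnion C) : IsClosed C := by
  obtain ⟨F, hF, hFI, rfl⟩ := h
  rw [Set.sUnion_eq_biUnion]
  exact hF.isClosed_biUnion fun I hI => (hFI I hI).isClosed

theorem frontier_union_finite {X : Type*} [TopologicalSpace X] {s t : Set X}
    (hs : (frontier s).Finite) (ht : (frontier t).Finite) : (frontier (s ∪ t)).Finite :=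
  (hs.union ht).subset ((frontier_union_subset s t).trans
    (Set.union_subset_union Set.inter_subset_left Set.inter_subset_right))

theorem IsIntervalUnion.frontier_finite {C : Set RP1} (h : IsIntervalUnion C) :
    (frontier C).Finite := by
  obtain ⟨F, hF, hFI, rfl⟩ := h
  induction F, hF using Set.Finite.induction_on with
  | empty => simp
  | @insert I F _ _ ih =>
    rw [Set.sUnion_insert]
    obtain ⟨v, w, hvw, hI⟩ := isClosedInterval_iff.1 (hFI I (Set.mem_insert _ _))
    exact frontier_union_finite (hI ▸ frontier_sector_finite hvw)
      (ih fun J hJ => hFI J (Set.mem_insert_of_mem _ hJ))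

theorem IsMulticone.interior_nonempty {C : Set RP1} (h : IsMulticone C) :
    (interior C).Nonempty := by
  obtain ⟨⟨F, hF, hFI, rfl⟩, ⟨L, I, hI, -⟩, -⟩ := h
  exact (hFI I hI).interior_nonempty.mono (interior_mono (Set.subset_sUnion_of_mem hI))

/-- With a single frontier point `p`, the interior and the complement of `C` would disconnect the
projective line minus `p`. -/
theorem IsMulticone.frontier_nontrivial {C : Set RP1} (h : IsMulticone C) :
    (frontier C).Nontrivial := by
  have hcl : IsClosed C := IsIntervalUnion.isClosed h.1
  by_contra hn
  obtain ⟨p, hp⟩ := nonempty_frontier_iff.2 h.2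
  have hfr : frontier C ⊆ {p} := fun q hq =>
    Set.not_nontrivial_iff.1 hn hq hp
  rw [hcl.frontier_eq] at hp hfr
  obtain ⟨x, hx⟩ := h.interior_nonempty
  obtain ⟨y, hy⟩ := Set.nonempty_compl.2 h.2.2
  obtain ⟨z, -, hz1, hz2⟩ := isPreconnected_compl_singleton p (interior C) Cᶜ isOpen_interior
    hcl.isOpen_compl
    (fun z hz => by
      by_cases h1 : z ∈ C
      · left
        by_contra h2
        exact hz (hfr ⟨h1, h2⟩)
      · exact Or.inr h1)
    ⟨x, by rintro rfl; exact hp.2 hx, hx⟩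
    ⟨y, by rintro rfl; exact hy hp.1, hy⟩
  exact hz2 (interior_subset hz1)

/-- Every line has arbitrarily small neighbourhoods which are closed intervals. -/
theorem exists_isClosedInterval_nhds (L : RP1) {U : Set RP1} (hU : U ∈ 𝓝 L) :
    ∃ I, IsClosedInterval I ∧ L ∈ interior I ∧ I ⊆ U := by
  obtain ⟨θ, rfl⟩ := lineOfAngle_surjective L
  obtain ⟨ε, hε, h⟩ := Metric.nhds_basis_closedBall.mem_iff.1
    (continuous_lineOfAngle.continuousAt.preimage_mem_nhds hU)
  set δ := min ε 1
  have hδ : 0 < δ := lt_min hε one_pos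
  have hδ1 : δ ≤ 1 := min_le_right _ _
  have hpi := Real.pi_gt_three
  refine ⟨lineOfAngle '' Set.Icc (θ - δ) (θ + δ), ⟨_, _, by linarith, by linarith, rfl⟩, ?_, ?_⟩
  · rw [image_lineOfAngle_Icc (by linarith) (by linarith)]
    apply mk_mem_interior_sector
    rw [cross_angle, cross_angle]
    exact mul_pos (Real.sin_pos_of_pos_of_lt_pi (by linarith) (by linarith))
      (Real.sin_pos_of_pos_of_lt_pi (by linarith) (by linarith))
  · rintro _ ⟨x, hx, rfl⟩
    apply h
    rw [Real.closedBall_eq_Icc]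
    have : δ ≤ ε := min_le_left _ _
    exact ⟨by linarith [hx.1], by linarith [hx.2]⟩

/-- A compact set has arbitrarily small neighbourhoods which are finite unions of intervals. -/
theorem exists_isIntervalUnion_between {K U : Set RP1} (hK : IsCompact K) (hU : IsOpen U)
    (hKU : K ⊆ U) : ∃ N, IsIntervalUnion N ∧ K ⊆ interior N ∧ N ⊆ U := by
  refine hK.induction_on (p := fun K => ∃ N, IsIntervalUnion N ∧ K ⊆ interior N ∧ N ⊆ U)
      ⟨∅, isIntervalUnion_empty, Set.empty_subset _, Set.empty_subset _⟩ ?_ ?_ ?_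
  · rintro s t hst ⟨N, h1, h2, h3⟩
    exact ⟨N, h1, hst.trans h2, h3⟩
  · rintro s t ⟨N, h1, h2, h3⟩ ⟨N', h1', h2', h3'⟩
    exact ⟨N ∪ N', h1.union h1', (Set.union_subset_union h2 h2').trans
      (Set.union_subset (interior_mono Set.subset_union_left)
        (interior_mono Set.subset_union_right)), Set.union_subset h3 h3'⟩
  · intro x hx
    obtain ⟨I, hI, hxI, hIU⟩ := exists_isClosedInterval_nhds x (hU.mem_nhds (hKU hx))
    exact ⟨interior I, mem_nhdsWithin_of_mem_nhds (isOpen_interior.mem_nhds hxI),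
      I, hI.isIntervalUnion, subset_rfl, hIU⟩

/-! ### Eigenvectors and tame matrices -/

theorem gl_ext_of_smul {g h : GL (Fin 2) ℝ} {v w : Fin 2 → ℝ} (hvw : cross v w ≠ 0)
    (hv : g • v = h • v) (hw : g • w = h • w) : g = h := by
  refine Units.ext (Matrix.toLin'.injective (LinearMap.ext fun u => ?_))
  rw [Matrix.toLin'_apply, Matrix.toLin'_apply]
  change g • u = h • u
  refine smul_right_injective _ hvw ?_
  simp only [← gl_smul_smul, cross_expand v w u]
  simp only [smul_add, gl_smul_smul, hv, hw]

theorem smul_mk_eq_iff (g : GL (Fin 2) ℝ) {v : Fin 2 → ℝ} (hv : v ≠ 0) :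
    g • mk ℝ v hv = mk ℝ v hv ↔ ∃ a : ℝ, g • v = a • v := by
  rw [smul_mk, mk_eq_mk_iff']
  exact ⟨fun ⟨a, h⟩ => ⟨a, h.symm⟩, fun ⟨a, h⟩ => ⟨a, h.symm⟩⟩

theorem det_eq_of_eigen {g : GL (Fin 2) ℝ} {v w : Fin 2 → ℝ} {a b : ℝ} (hvw : cross v w ≠ 0)
    (hv : g • v = a • v) (hw : g • w = b • w) :
    (g : Matrix (Fin 2) (Fin 2) ℝ).det = a * b := by
  have h := cross_gl_smul g v w
  rw [hv, hw, cross_smul_left, cross_smul_right, ← mul_assoc] at h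
  exact (mul_right_cancel₀ hvw h).symm

theorem cross_ne_zero_of_eigen {g : GL (Fin 2) ℝ} {v w : Fin 2 → ℝ} {a b : ℝ} (hv : v ≠ 0)
    (hw : w ≠ 0) (hva : g • v = a • v) (hwb : g • w = b • w) (hab : a ≠ b) : cross v w ≠ 0 := by
  intro h
  obtain ⟨c, rfl⟩ := exists_smul_of_cross_eq_zero hw h
  rw [gl_smul_smul, hwb, smul_comm, ← sub_eq_zero, ← sub_smul] at hva
  rcases smul_eq_zero.1 hva with h | h
  · exact hab (sub_eq_zero.1 h).symm
  · exact hv h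

/-- `t` maps `C` into itself, is not parabolic, and, if it is proximal, its stable direction is not
in `C` and its unstable direction is not in the frontier of `C`. -/
structure IsTame (C : Set RP1) (t : GL (Fin 2) ℝ) : Prop where
  smul_subset : t • C ⊆ C
  exists_eigen : ∀ (v : Fin 2 → ℝ) (a : ℝ), v ≠ 0 → t • v = a • v →
    ∃ (w : Fin 2 → ℝ) (b : ℝ), cross v w ≠ 0 ∧ t • w = b • w
  directions : ∀ (v w : Fin 2 → ℝ) (a b : ℝ) (hv : v ≠ 0) (hw : w ≠ 0), t • v = a • v →
    t • w = b • w → |b| < |a| →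
      Projectivization.mk ℝ v hv ∉ frontier C ∧ Projectivization.mk ℝ w hw ∉ C

section Tame

variable {C : Set RP1} {t : GL (Fin 2) ℝ}

/-- If the moduli differed, the line of `v` would be either an unstable direction on the frontier or
a stable direction in the closed set `C`. -/
theorem IsTame.abs_eq_abs (ht : IsTame C t) (hC : IsClosed C) {v w : Fin 2 → ℝ} {a b : ℝ}
    (hv : v ≠ 0) (hw : w ≠ 0) (hva : t • v = a • v) (hwb : t • w = b • w)
    (hvC : Projectivization.mk ℝ v hv ∈ frontier C) : |a| = |b| := by
  rcases lt_trichotomy |a| |b| with h | h | h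
  · exact absurd (hC.frontier_subset hvC) (ht.directions w v b a hw hv hwb hva h).2
  · exact h
  · exact absurd hvC (ht.directions v w a b hv hw hva hwb h).1

/-- The square of a tame matrix fixing a frontier point is scalar. -/
theorem IsTame.sq_smul (ht : IsTame C t) (hC : IsClosed C) {p : RP1} (hp : p ∈ frontier C)
    (htp : t • p = p) : ∃ a : ℝ, a ≠ 0 ∧ |(t : Matrix (Fin 2) (Fin 2) ℝ).det| = a ^ 2 ∧
      ∀ u : Fin 2 → ℝ, t • t • u = a ^ 2 • u := by
  obtain ⟨v, hv, rfl⟩ := exists_eq_mk p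
  obtain ⟨a, hva⟩ := (smul_mk_eq_iff t hv).1 htp
  obtain ⟨w, b, hvw, hwb⟩ := ht.exists_eigen v a hv hva
  have hab := ht.abs_eq_abs hC hv (ne_zero_right_of_cross hvw) hva hwb hp
  have hdet := det_eq_of_eigen hvw hva hwb
  refine ⟨a, ?_, ?_, fun u => ?_⟩
  · rintro rfl
    exact det_gl_ne_zero t (by rw [hdet, zero_mul])
  · rw [hdet, abs_mul, ← hab, ← sq, sq_abs]
  · have hab2 : b ^ 2 = a ^ 2 := by rw [← sq_abs b, ← hab, sq_abs]
    refine smul_right_injective _ hvw ?_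
    simp only [smul_comm (cross v w) (a ^ 2)]
    simp only [← gl_smul_smul, cross_expand v w u]
    simp only [smul_add, gl_smul_smul, hva, hwb, smul_smul, ← hab2]
    rw [show cross u w * a * a = b ^ 2 * cross u w by rw [hab2]; ring,
      show cross v u * b * b = b ^ 2 * cross v u by ring]

/-- A scalar square acts trivially on lines, so `C = t • t • C ⊆ t • C`. -/
theorem IsTame.smul_eq (ht : IsTame C t) (hC : IsClosed C) {p : RP1} (hp : p ∈ frontier C)
    (htp : t • p = p) : t • C = C := by
  obtain ⟨a, ha, -, h⟩ := ht.sq_smul hC hp htp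
  have h2 : ∀ x : RP1, t • t • x = x := by
    intro x
    obtain ⟨u, hu, rfl⟩ := exists_eq_mk x
    rw [smul_mk, smul_mk, mk_eq_mk_iff']
    exact ⟨a ^ 2, (h u).symm⟩
  refine ht.smul_subset.antisymm fun x hx => ?_
  rw [← h2 x]
  exact Set.smul_mem_smul_set (ht.smul_subset (Set.smul_mem_smul_set hx))

/-- A proximal tame matrix does not map a closed set with at least two points onto itself. -/
theorem IsTame.smul_ne_of_proximal (ht : IsTame C t) (hC : IsClosed C) (hC2 : C.Nontrivial)
    {v w : Fin 2 → ℝ} {a b : ℝ} (hv : v ≠ 0) (hw : w ≠ 0) (hva : t • v = a • v)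
    (hwb : t • w = b • w) (hab : |b| < |a|) : t • C ≠ C := by
  intro htC
  refine (ht.directions v w a b hv hw hva hwb hab).2 ?_
  have ha : a ≠ 0 := by
    rintro rfl
    rw [abs_zero] at hab
    exact absurd hab (abs_nonneg b).not_gt
  have hvw : cross v w ≠ 0 := cross_ne_zero_of_eigen hv hw hva hwb (by
    rintro rfl
    exact lt_irrefl _ hab)
  have hb : b ≠ 0 := by
    rintro rfl
    exact det_gl_ne_zero t (by rw [det_eq_of_eigen hvw hva hwb, mul_zero])
  obtain ⟨x, hxC, hxv⟩ := hC2.exists_ne (Projectivization.mk ℝ v hv)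
  obtain ⟨u, hu, rfl⟩ := exists_eq_mk x
  have hvu : cross v u ≠ 0 := by
    intro h
    apply hxv
    rw [mk_eq_mk_iff_cross, cross_swap, h, neg_zero]
  set α := cross u w
  set β := cross v u
  -- Up to scalars, `f 1` is `u`, `f ((b / a) ^ n)` is the image of `u` under the `n`-th power of
  -- the inverse of `t`, and `f 0` is `w`. If `t • C = C`, these backward iterates stay in `C` and
  -- converge to the stable direction.
  set f : ℝ → Fin 2 → ℝ := fun s => (s * α) • v + β • w
  have hf0 : ∀ s, f s ≠ 0 := by
    intro s h
    have : cross v (f s) = 0 := by rw [h]; simp [cross]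
    have h' : cross v (f s) = β * cross v w := by simp [f, cross]; ring
    rw [h'] at this
    exact mul_ne_zero hvu hvw this
  have hcont : Continuous fun s => Projectivization.mk ℝ (f s) (hf0 s) := by
    refine continuous_mk_comp ?_ _
    fun_prop
  have h0 : Projectivization.mk ℝ w hw = Projectivization.mk ℝ (f 0) (hf0 0) := by
    rw [mk_eq_mk_iff_cross]
    simp [f, cross]; ring
  have hmem : ∀ n : ℕ, Projectivization.mk ℝ (f ((b / a) ^ n)) (hf0 _) ∈ C := by
    intro n
    induction n with
    | zero =>
      convert hxC using 1
      rw [mk_eq_mk_iff']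
      refine ⟨cross v w, ?_⟩
      rw [cross_expand v w u]
      simp [f, α, β]
    | succ n ih =>
      rw [← htC] at ih
      obtain ⟨y, hy, hty⟩ := ih
      convert hy using 1
      have hty : t • y = Projectivization.mk ℝ (f ((b / a) ^ n)) (hf0 _) := hty
      refine MulAction.injective t ?_
      beta_reduce
      rw [hty, smul_mk, mk_eq_mk_iff']
      refine ⟨b, ?_⟩
      simp only [f, smul_add, gl_smul_smul, hva, hwb, smul_smul]
      congr 2
      · have hba : a * (b / a) = b := by field_simp
        rw [pow_succ]
        linear_combination (-(b / a) ^ n * α) * hba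
      · ring
  rw [h0]
  have hlim : Tendsto (fun n : ℕ => (b / a) ^ n) atTop (𝓝 0) := by
    apply tendsto_pow_atTop_nhds_zero_of_abs_lt_one
    rwa [abs_div, div_lt_one (abs_pos.2 ha)]
  exact hC.mem_of_tendsto ((hcont.tendsto 0).comp hlim) (Eventually.of_forall hmem)

end Tame

/-! ### The finite stabilizer of the multicone -/

section Stabilizer

variable {C : Set RP1} {T : Submonoid (GL (Fin 2) ℝ)}

theorem smul_frontier {t : GL (Fin 2) ℝ} (h : t • C = C) : t • frontier C = frontier C := by
  rw [frontier, Set.smul_set_sdiff, ← interior_smul, ← closure_smul, h]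

/-- By the pigeonhole principle a power of `t` fixes a frontier point. Its square is then scalar
with factor `|det| = 1`. -/
theorem exists_pow_eq_one (hC : IsMulticone C) (hT : ∀ t ∈ T, IsTame C t) {t : GL (Fin 2) ℝ}
    (ht : t ∈ T) (htC : t • C = C) (hdet : |(t : Matrix (Fin 2) (Fin 2) ℝ).det| = 1) :
    ∃ n : ℕ, t ^ (n + 1) = 1 := by
  have hcl : IsClosed C := IsIntervalUnion.isClosed hC.1
  obtain ⟨p, hp⟩ := hC.frontier_nontrivial.nonempty
  have hmem : ∀ n : ℕ, t ^ n • p ∈ frontier C := by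
    intro n
    induction n with
    | zero => simpa using hp
    | succ n ih =>
      rw [pow_succ', mul_smul, ← smul_frontier htC]
      exact Set.smul_mem_smul_set ih
  obtain ⟨m, n, hmn, h⟩ :=
    (IsIntervalUnion.frontier_finite hC.1).exists_lt_map_eq_of_forall_mem hmem
  obtain ⟨k, rfl⟩ := Nat.exists_eq_add_of_lt hmn
  have hk : t ^ (k + 1) • p = p := by
    rw [add_assoc, pow_add, mul_smul] at h
    exact (MulAction.injective (t ^ m) h).symm
  obtain ⟨a, -, ha2, ha⟩ := (hT _ (T.pow_mem ht (k + 1))).sq_smul hcl hp hk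
  have ha1 : a ^ 2 = 1 := by
    rw [← ha2, Units.val_pow_eq_pow_val, Matrix.det_pow, abs_pow, hdet, one_pow]
  refine ⟨2 * k + 1, ?_⟩
  have hvw : cross ![1, 0] ![0, 1] ≠ 0 := by simp [cross]
  have hu : ∀ u : Fin 2 → ℝ, t ^ (2 * k + 1 + 1) • u = (1 : GL (Fin 2) ℝ) • u := by
    intro u
    rw [show 2 * k + 1 + 1 = (k + 1) + (k + 1) by ring, pow_add, mul_smul, ha, ha1, one_smul,
      one_smul]
  exact gl_ext_of_smul hvw (hu _) (hu _)

/-- The group of all elements of `T` of determinant `±1` which map `C` onto itself. -/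
def stabilizerGroup (hC : IsMulticone C) (hT : ∀ t ∈ T, IsTame C t) :
    Subgroup (GL (Fin 2) ℝ) where
  carrier := {t | t ∈ T ∧ t • C = C ∧ |(t : Matrix (Fin 2) (Fin 2) ℝ).det| = 1}
  one_mem' := ⟨T.one_mem, one_smul _ _, by simp⟩
  mul_mem' := by
    rintro s t ⟨hs, hsC, hsd⟩ ⟨ht, htC, htd⟩
    refine ⟨T.mul_mem hs ht, by rw [mul_smul, htC, hsC], ?_⟩
    rw [Units.val_mul, Matrix.det_mul, abs_mul, hsd, htd, one_mul]
  inv_mem' := by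
    rintro t ⟨ht, htC, htd⟩
    -- `T` is only a monoid, but finite order makes the inverse a nonnegative power.
    obtain ⟨n, hn⟩ := exists_pow_eq_one hC hT ht htC htd
    have hinv : t⁻¹ = t ^ n := by
      rw [inv_eq_iff_mul_eq_one, ← pow_succ', hn]
    refine ⟨hinv ▸ T.pow_mem ht n, ?_, ?_⟩
    · rw [inv_smul_eq_iff, htC]
    · rw [hinv, Units.val_pow_eq_pow_val, Matrix.det_pow, abs_pow, htd, one_pow]

theorem finite_diagonal_signs {v w : Fin 2 → ℝ} (hvw : cross v w ≠ 0) :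
    {g : GL (Fin 2) ℝ | ∃ a ∈ ({1, -1} : Set ℝ), ∃ b ∈ ({1, -1} : Set ℝ),
      g • v = a • v ∧ g • w = b • w}.Finite := by
  have h1 : ({1, -1} : Set ℝ).Finite := Set.toFinite _
  refine Set.Finite.subset (h1.biUnion fun a _ => h1.biUnion
    (t := fun b => {g : GL (Fin 2) ℝ | g • v = a • v ∧ g • w = b • w}) fun b _ =>
      Set.Subsingleton.finite ?_) ?_
  · rintro g ⟨hg1, hg2⟩ h ⟨hh1, hh2⟩
    exact gl_ext_of_smul hvw (hg1.trans hh1.symm) (hg2.trans hh2.symm)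
  · rintro g ⟨a, ha, b, hb, h⟩
    simp only [Set.mem_iUnion]
    exact ⟨a, ha, b, hb, h⟩

/-- The images of two distinct frontier points take finitely many values. Two elements with the same
images differ by a factor fixing both points, whose eigenvalues have equal modulus and product `±1`,
hence are signs. -/
theorem stabilizerGroup_finite (hC : IsMulticone C) (hT : ∀ t ∈ T, IsTame C t) :
    (stabilizerGroup hC hT : Set (GL (Fin 2) ℝ)).Finite := by
  have hcl : IsClosed C := IsIntervalUnion.isClosed hC.1
  have hfin := IsIntervalUnion.frontier_finite hC.1
  obtain ⟨p, hp, q, hq, hpq⟩ := hC.frontier_nontrivial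
  obtain ⟨v, hv, rfl⟩ := exists_eq_mk p
  obtain ⟨w, hw, rfl⟩ := exists_eq_mk q
  have hvw : cross v w ≠ 0 := fun h => hpq ((mk_eq_mk_iff_cross hv hw).2 h)
  refine Set.Finite.of_finite_fibers
    (fun t => (t • Projectivization.mk ℝ v hv, t • Projectivization.mk ℝ w hw)) ?_ ?_
  · refine (hfin.prod hfin).subset ?_
    rintro _ ⟨t, ht, rfl⟩
    have h := smul_frontier ht.2.1
    refine ⟨?_, ?_⟩
    · rw [← h]; exact Set.smul_mem_smul_set hp
    · rw [← h]; exact Set.smul_mem_smul_set hq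
  · rintro _ ⟨t, ht, rfl⟩
    refine ((finite_diagonal_signs hvw).image (t * ·)).subset ?_
    rintro s ⟨hs, hst⟩
    have hst1 : s • Projectivization.mk ℝ v hv = t • Projectivization.mk ℝ v hv :=
      congrArg Prod.fst hst
    have hst2 : s • Projectivization.mk ℝ w hw = t • Projectivization.mk ℝ w hw :=
      congrArg Prod.snd hst
    refine ⟨t⁻¹ * s, ?_, mul_inv_cancel_left t s⟩
    have hr := (stabilizerGroup hC hT).mul_mem ((stabilizerGroup hC hT).inv_mem ht) hs
    obtain ⟨a, ha⟩ := (smul_mk_eq_iff (t⁻¹ * s) hv).1 (by rw [mul_smul, hst1, inv_smul_smul])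
    obtain ⟨b, hb⟩ := (smul_mk_eq_iff (t⁻¹ * s) hw).1 (by rw [mul_smul, hst2, inv_smul_smul])
    have hab := (hT _ hr.1).abs_eq_abs hcl hv hw ha hb hp
    have hd := hr.2.2
    rw [det_eq_of_eigen hvw ha hb, abs_mul, hab] at hd
    have hb1 : |b| = 1 := by nlinarith [abs_nonneg b]
    refine ⟨a, ?_, b, ?_, ha, hb⟩
    · exact eq_or_eq_neg_of_abs_eq (hab.trans hb1)
    · exact eq_or_eq_neg_of_abs_eq hb1

end Stabilizer

/-! ### Proximality and parabolicity through eigenvectors -/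

section Eigen

variable {g : GL (Fin 2) ℝ}

theorem mem_eigenspace_iff {a : ℝ} {v : Fin 2 → ℝ} :
    v ∈ (toEnd g).eigenspace a ↔ g • v = a • v :=
  Module.End.mem_eigenspace_iff

theorem hasEigenvalue_iff {a : ℝ} :
    (toEnd g).HasEigenvalue a ↔ ∃ v : Fin 2 → ℝ, v ≠ 0 ∧ g • v = a • v := by
  constructor
  · intro h
    obtain ⟨v, hv⟩ := h.exists_hasEigenvector
    exact ⟨v, hv.2, mem_eigenspace_iff.1 hv.1⟩
  · rintro ⟨v, hv, h⟩
    exact Module.End.hasEigenvalue_of_hasEigenvector ⟨mem_eigenspace_iff.2 h, hv⟩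

theorem eigenvalue_ne_zero {a : ℝ} {v : Fin 2 → ℝ} (hv : v ≠ 0) (h : g • v = a • v) : a ≠ 0 := by
  rintro rfl
  rw [zero_smul] at h
  exact (smul_ne_zero_iff_ne g).2 hv h

/-- For `x` in the eigenspace of `a`, computing `cross (g • x) (g • v)` from the eigenvalue and from
`det = a * b` gives `a * (a - b) * cross x v = 0`. -/
theorem span_eq_eigenspace {v w : Fin 2 → ℝ} {a b : ℝ} (hv : v ≠ 0) (hw : w ≠ 0)
    (hva : g • v = a • v) (hwb : g • w = b • w) (hab : a ≠ b) :
    (mk ℝ v hv).submodule = (toEnd g).eigenspace a := by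
  rw [submodule_mk]
  ext x
  rw [Submodule.mem_span_singleton, mem_eigenspace_iff]
  constructor
  · rintro ⟨c, rfl⟩
    rw [gl_smul_smul, hva, smul_comm]
  · intro hx
    apply exists_smul_of_cross_eq_zero hv
    have h := cross_gl_smul g x v
    rw [det_eq_of_eigen (cross_ne_zero_of_eigen hv hw hva hwb hab) hva hwb, hx, hva,
      cross_smul_left, cross_smul_right] at h
    have h' : a * ((a - b) * cross x v) = 0 := by linear_combination h
    exact (mul_eq_zero.1 ((mul_eq_zero.1 h').resolve_left
      (eigenvalue_ne_zero hv hva))).resolve_left (sub_ne_zero.2 hab)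

theorem directions_of_eigen {v w : Fin 2 → ℝ} {a b : ℝ} (hv : v ≠ 0) (hw : w ≠ 0)
    (hva : g • v = a • v) (hwb : g • w = b • w) (hab : |b| < |a|) :
    IsProximal g ∧ IsUnstableDirection g (mk ℝ v hv) ∧ IsStableDirection g (mk ℝ w hw) := by
  have ha := hasEigenvalue_iff.2 ⟨v, hv, hva⟩
  have hb := hasEigenvalue_iff.2 ⟨w, hw, hwb⟩
  have hne : a ≠ b := by rintro rfl; exact lt_irrefl _ hab
  exact ⟨⟨a, b, ha, hb, hab.ne'⟩, ⟨a, b, ha, hb, hab, span_eq_eigenspace hv hw hva hwb hne⟩,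
    ⟨a, b, ha, hb, hab, span_eq_eigenspace hw hv hwb hva hne.symm⟩⟩

theorem IsProximal.exists_eigen (h : IsProximal g) : ∃ (v w : Fin 2 → ℝ) (a b : ℝ),
    v ≠ 0 ∧ w ≠ 0 ∧ g • v = a • v ∧ g • w = b • w ∧ |b| < |a| := by
  obtain ⟨a, b, ha, hb, hab⟩ := h
  obtain ⟨v, hv, hva⟩ := hasEigenvalue_iff.1 ha
  obtain ⟨w, hw, hwb⟩ := hasEigenvalue_iff.1 hb
  rcases hab.lt_or_gt with h | h
  · exact ⟨w, v, b, a, hw, hv, hwb, hva, h⟩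
  · exact ⟨v, w, a, b, hv, hw, hva, hwb, h⟩

theorem exists_eigen_of_not_isParabolic (h : ¬ IsParabolic g) {v : Fin 2 → ℝ} {a : ℝ} (hv : v ≠ 0)
    (hva : g • v = a • v) : ∃ (w : Fin 2 → ℝ) (b : ℝ), cross v w ≠ 0 ∧ g • w = b • w := by
  by_contra! hcon
  refine h ⟨a, fun b => ⟨fun hb => ?_, ?_⟩, ?_⟩
  · by_contra hne
    obtain ⟨w, hw, hwb⟩ := hasEigenvalue_iff.1 hb
    exact hcon w b (cross_ne_zero_of_eigen hv hw hva hwb (Ne.symm hne)) hwb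
  · rintro rfl
    exact hasEigenvalue_iff.2 ⟨v, hv, hva⟩
  · have : (toEnd g).eigenspace a = Submodule.span ℝ {v} := by
      ext x
      rw [Submodule.mem_span_singleton, mem_eigenspace_iff]
      constructor
      · intro hx
        apply exists_smul_of_cross_eq_zero hv
        by_contra hne
        refine hcon x a ?_ hx
        rwa [cross_swap, neg_ne_zero]
      · rintro ⟨c, rfl⟩
        rw [gl_smul_smul, hva, smul_comm]
    rw [this, finrank_span_singleton hv]

end Eigen

/-! ### Conformal matrices and invariant quadratic forms -/

section Conformal

theorem abs_det_pos (g : GL (Fin 2) ℝ) : 0 < |(g : Matrix (Fin 2) (Fin 2) ℝ).det| :=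
  abs_pos.2 (det_gl_ne_zero g)

theorem det_conj (M g : GL (Fin 2) ℝ) :
    ((M * g * M⁻¹ : GL (Fin 2) ℝ) : Matrix (Fin 2) (Fin 2) ℝ).det =
      (g : Matrix (Fin 2) (Fin 2) ℝ).det := by
  have h : ((M * g * M⁻¹ : GL (Fin 2) ℝ) : Matrix (Fin 2) (Fin 2) ℝ).det *
      (M : Matrix (Fin 2) (Fin 2) ℝ).det =
      (M : Matrix (Fin 2) (Fin 2) ℝ).det * (g : Matrix (Fin 2) (Fin 2) ℝ).det := by
    rw [← Matrix.det_mul, ← Matrix.det_mul, ← Units.val_mul, ← Units.val_mul, inv_mul_cancel_right]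
  rw [mul_comm] at h
  exact mul_left_cancel₀ (det_gl_ne_zero M) h

/-- Conjugation by `M` turns the form `Mᵀ M` into the standard inner product, so scaling that form
by `|det g|` amounts to orthogonality after normalization. -/
theorem isConformalWith_of_form {M g : GL (Fin 2) ℝ}
    (h : (g : Matrix (Fin 2) (Fin 2) ℝ).transpose *
      ((M : Matrix (Fin 2) (Fin 2) ℝ).transpose * (M : Matrix (Fin 2) (Fin 2) ℝ)) *
        (g : Matrix (Fin 2) (Fin 2) ℝ) =
      |(g : Matrix (Fin 2) (Fin 2) ℝ).det| •
        ((M : Matrix (Fin 2) (Fin 2) ℝ).transpose * (M : Matrix (Fin 2) (Fin 2) ℝ))) :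
    IsConformalWith M g := by
  rw [IsConformalWith, Matrix.mem_orthogonalGroup_iff', normalized, det_conj,
    Matrix.transpose_smul, smul_mul_smul_comm]
  have hd := abs_det_pos g
  set d := |(g : Matrix (Fin 2) (Fin 2) ℝ).det|
  have hc : d ^ (-(1 / 2) : ℝ) * d ^ (-(1 / 2) : ℝ) = d⁻¹ := by
    rw [← Real.rpow_add hd, ← Real.rpow_neg_one]
    norm_num
  rw [hc]
  have hM : (M : Matrix (Fin 2) (Fin 2) ℝ) * ((M⁻¹ : GL (Fin 2) ℝ) : Matrix (Fin 2) (Fin 2) ℝ) =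
      1 :=
    M.mul_inv
  simp only [Units.val_mul, Matrix.transpose_mul]
  set N : Matrix (Fin 2) (Fin 2) ℝ := ((M⁻¹ : GL (Fin 2) ℝ) : Matrix (Fin 2) (Fin 2) ℝ)
  have e : N.transpose * (((g : Matrix (Fin 2) (Fin 2) ℝ)).transpose *
      (M : Matrix (Fin 2) (Fin 2) ℝ).transpose) *
      ((M : Matrix (Fin 2) (Fin 2) ℝ) * (g : Matrix (Fin 2) (Fin 2) ℝ) * N) =
      N.transpose * ((g : Matrix (Fin 2) (Fin 2) ℝ).transpose *
      ((M : Matrix (Fin 2) (Fin 2) ℝ).transpose * (M : Matrix (Fin 2) (Fin 2) ℝ)) *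
        (g : Matrix (Fin 2) (Fin 2) ℝ)) * N := by
    simp only [Matrix.mul_assoc]
  have e2 : N.transpose * ((M : Matrix (Fin 2) (Fin 2) ℝ).transpose *
      (M : Matrix (Fin 2) (Fin 2) ℝ)) * N = 1 := by
    rw [Matrix.mul_assoc, Matrix.mul_assoc, hM, Matrix.mul_one, ← Matrix.transpose_mul, hM,
      Matrix.transpose_one]
  rw [e, h, Matrix.mul_smul, Matrix.smul_mul, e2, smul_smul, inv_mul_cancel₀ hd.ne', one_smul]

/-- Cholesky decomposition of a positive definite `2 × 2` matrix. -/
theorem exists_gl_transpose_mul_self {P : Matrix (Fin 2) (Fin 2) ℝ} (hs : P 1 0 = P 0 1)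
    (h0 : 0 < P 0 0) (hd : 0 < P.det) :
    ∃ M : GL (Fin 2) ℝ, (M : Matrix (Fin 2) (Fin 2) ℝ).transpose *
      (M : Matrix (Fin 2) (Fin 2) ℝ) = P := by
  have h1 : √(P 0 0) ≠ 0 := (Real.sqrt_pos.2 h0).ne'
  have h2 : √(P.det / P 0 0) ≠ 0 := (Real.sqrt_pos.2 (div_pos hd h0)).ne'
  set M : Matrix (Fin 2) (Fin 2) ℝ :=
    !![√(P 0 0), P 0 1 / √(P 0 0); 0, √(P.det / P 0 0)] with hM
  have hdet : M.det ≠ 0 := by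
    rw [hM, Matrix.det_fin_two_of, mul_zero, sub_zero]
    exact mul_ne_zero h1 h2
  refine ⟨Matrix.GeneralLinearGroup.mkOfDetNeZero M hdet, ?_⟩
  change M.transpose * M = P
  have e1 := Real.mul_self_sqrt h0.le
  have e2 := Real.mul_self_sqrt (div_pos hd h0).le
  ext i j
  fin_cases i <;> fin_cases j
  · simp [Matrix.mul_apply, hM, e1]
  · simp [Matrix.mul_apply, hM]
    field_simp
  · simp [Matrix.mul_apply, hM, hs]
    field_simp
  · simp [Matrix.mul_apply, hM, e2]
    rw [div_mul_div_comm, e1, Matrix.det_fin_two, hs]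
    field_simp
    ring

theorem exists_isConformalWith_of_posDef {P : Matrix (Fin 2) (Fin 2) ℝ} (hP : P.PosDef) :
    ∃ M : GL (Fin 2) ℝ, ∀ g : GL (Fin 2) ℝ, (g : Matrix (Fin 2) (Fin 2) ℝ).transpose * P *
      (g : Matrix (Fin 2) (Fin 2) ℝ) = |(g : Matrix (Fin 2) (Fin 2) ℝ).det| • P →
      IsConformalWith M g := by
  obtain ⟨M, rfl⟩ := exists_gl_transpose_mul_self (P := P) (by simpa using hP.1.apply 0 1)
    hP.diag_pos hP.det_pos
  exact ⟨M, fun g h => isConformalWith_of_form h⟩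

theorem posDef_transpose_mul_self (g : GL (Fin 2) ℝ) :
    ((g : Matrix (Fin 2) (Fin 2) ℝ).transpose * (g : Matrix (Fin 2) (Fin 2) ℝ)).PosDef := by
  have h := Matrix.PosDef.conjTranspose_mul_self (g : Matrix (Fin 2) (Fin 2) ℝ)
    (MulAction.injective g)
  rwa [Matrix.conjTranspose_eq_transpose_of_trivial] at h

/-- A finite group of matrices is strongly conformal. -/
theorem isStronglyConformal_of_finite (G : Subgroup (GL (Fin 2) ℝ))
    (hG : (G : Set (GL (Fin 2) ℝ)).Finite)
    (hdet : ∀ g ∈ G, |(g : Matrix (Fin 2) (Fin 2) ℝ).det| = 1) :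
    IsStronglyConformal (G : Set (GL (Fin 2) ℝ)) := by
  -- The averaged inner product; right multiplication by a group element permutes its summands.
  set P : Matrix (Fin 2) (Fin 2) ℝ := ∑ h ∈ hG.toFinset,
    (h : Matrix (Fin 2) (Fin 2) ℝ).transpose * (h : Matrix (Fin 2) (Fin 2) ℝ) with hPdef
  have hP : P.PosDef := by
    rw [hPdef, ← Finset.add_sum_erase _ _ (hG.mem_toFinset.2 G.one_mem)]
    exact (posDef_transpose_mul_self 1).add_posSemidef
      (Matrix.posSemidef_sum _ fun h _ => (posDef_transpose_mul_self h).posSemidef)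
  obtain ⟨M, hM⟩ := exists_isConformalWith_of_posDef hP
  refine ⟨M, fun g hg => hM g ?_⟩
  rw [hdet g hg, one_smul, hPdef, Finset.mul_sum, Finset.sum_mul]
  refine Finset.sum_bij (fun h _ => h * g) (fun h hh => ?_) (fun _ _ _ _ h => mul_right_cancel h)
    (fun h hh => ⟨h * g⁻¹, ?_, inv_mul_cancel_right h g⟩) (fun h _ => ?_)
  · rw [hG.mem_toFinset] at hh ⊢
    exact G.mul_mem hh hg
  · rw [hG.mem_toFinset] at hh ⊢
    exact G.mul_mem hh (G.inv_mem hg)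
  · rw [Units.val_mul, Matrix.transpose_mul]
    simp only [Matrix.mul_assoc]

/-- Up to the factor `a ^ 2`, pulling back by `X` exchanges the two summands of the form `a ^ 2 • 1
+ Xᵀ X`. -/
theorem isConformal_of_sq_scalar {g : GL (Fin 2) ℝ} {a : ℝ} (ha : a ≠ 0)
    (hdet : |(g : Matrix (Fin 2) (Fin 2) ℝ).det| = a ^ 2)
    (h : (g : Matrix (Fin 2) (Fin 2) ℝ) * (g : Matrix (Fin 2) (Fin 2) ℝ) = a ^ 2 • 1) :
    IsConformal g := by
  set X := (g : Matrix (Fin 2) (Fin 2) ℝ)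
  have hP : ((a ^ 2) • (1 : Matrix (Fin 2) (Fin 2) ℝ) + X.transpose * X).PosDef :=
    (Matrix.PosDef.one.smul (by positivity)).add (posDef_transpose_mul_self g)
  obtain ⟨M, hM⟩ := exists_isConformalWith_of_posDef hP
  refine ⟨M, hM g ?_⟩
  change X.transpose * _ * X = |X.det| • _
  rw [hdet, Matrix.mul_add, Matrix.add_mul, Matrix.mul_smul, Matrix.smul_mul, Matrix.mul_one,
    smul_add]
  have : X.transpose * (X.transpose * X) * X = (X * X).transpose * (X * X) := by
    rw [Matrix.transpose_mul]; simp only [Matrix.mul_assoc]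
  rw [this, h, Matrix.transpose_smul, Matrix.transpose_one, Matrix.smul_mul, Matrix.one_mul,
    add_comm]

/-- The form `u ↦ cross u (g • u)` is multiplied by `det g` under `g`. Its determinant is minus a
quarter of the discriminant, so it is definite, and a sign `ε` makes it positive. -/
theorem isConformal_of_disc_neg {g : GL (Fin 2) ℝ}
    (h : (g.1 0 0 - g.1 1 1) ^ 2 + 4 * (g.1 0 1 * g.1 1 0) < 0) : IsConformal g := by
  set X := (g : Matrix (Fin 2) (Fin 2) ℝ) with hX
  have hdet : 0 < X.det := by
    rw [Matrix.det_fin_two]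
    nlinarith [sq_nonneg (X 0 0 + X 1 1)]
  have key : ∀ ε : ℝ, ε ^ 2 = 1 → 0 < ε * X 1 0 → IsConformal g := by
    intro ε hε hpos
    obtain ⟨M, hM⟩ := exists_gl_transpose_mul_self
      (P := ε • !![X 1 0, (X 1 1 - X 0 0) / 2; (X 1 1 - X 0 0) / 2, -X 0 1])
      (by simp) (by simpa using hpos) (by
        rw [Matrix.det_smul, Matrix.det_fin_two_of, Fintype.card_fin, hε]
        nlinarith [h])
    refine ⟨M, isConformalWith_of_form ?_⟩
    rw [hM, ← hX, abs_of_pos hdet, Matrix.mul_smul, Matrix.smul_mul, smul_comm]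
    congr 1
    ext i j
    fin_cases i <;> fin_cases j <;>
      simp [Matrix.mul_apply, Fin.sum_univ_two, Matrix.det_fin_two] <;> ring
  have hne : X 1 0 ≠ 0 := by
    intro h0
    have h' : (X 0 0 - X 1 1) ^ 2 + 4 * (X 0 1 * X 1 0) < 0 := h
    rw [h0] at h'
    nlinarith [sq_nonneg (X 0 0 - X 1 1)]
  rcases hne.lt_or_gt with h0 | h0
  · exact key (-1) (by norm_num) (by linarith)
  · exact key 1 (by norm_num) (by linarith)

/-- Every invertible matrix is proximal, parabolic or conformal. -/
theorem isConformal_of_not_isProximal {g : GL (Fin 2) ℝ} (h1 : ¬ IsProximal g)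
    (h2 : ¬ IsParabolic g) : IsConformal g := by
  by_cases hd : (g.1 0 0 - g.1 1 1) ^ 2 + 4 * (g.1 0 1 * g.1 1 0) < 0
  · exact isConformal_of_disc_neg hd
  · set D := (g.1 0 0 - g.1 1 1) ^ 2 + 4 * (g.1 0 1 * g.1 1 0) with hD
    have hs := Real.mul_self_sqrt (not_lt.1 hd)
    -- A real root of the characteristic polynomial. Since `g` is neither parabolic nor proximal,
    -- there is a second independent eigenvector with eigenvalue of the same modulus, so the square
    -- of `g` is scalar.
    set a := (g.1 0 0 + g.1 1 1 + √D) / 2 with ha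
    have hdet : (g.1 - a • (1 : Matrix (Fin 2) (Fin 2) ℝ)).det = 0 := by
      rw [Matrix.det_fin_two]
      simp
      rw [ha]
      linear_combination hs / 4
    obtain ⟨v, hv, hva⟩ := Matrix.exists_mulVec_eq_zero_iff.2 hdet
    have hva : g • v = a • v := by
      rw [Matrix.sub_mulVec, Matrix.smul_mulVec, Matrix.one_mulVec] at hva
      exact sub_eq_zero.1 hva
    obtain ⟨w, b, hvw, hwb⟩ := exists_eigen_of_not_isParabolic h2 hv hva
    have hab : |a| = |b| := by
      by_contra hne
      exact h1 ⟨a, b, hasEigenvalue_iff.2 ⟨v, hv, hva⟩,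
        hasEigenvalue_iff.2 ⟨w, ne_zero_right_of_cross hvw, hwb⟩, hne⟩
    have ha0 := eigenvalue_ne_zero hv hva
    have hsq : b ^ 2 = a ^ 2 := by rw [← sq_abs b, ← hab, sq_abs]
    refine isConformal_of_sq_scalar ha0 ?_ ?_
    · rw [det_eq_of_eigen hvw hva hwb, abs_mul, ← hab, ← sq, sq_abs]
    · set z : GL (Fin 2) ℝ := Matrix.GeneralLinearGroup.scalar (Fin 2)
        (Units.mk0 (a ^ 2) (pow_ne_zero 2 ha0))
      have hz : (z : Matrix (Fin 2) (Fin 2) ℝ) = a ^ 2 • 1 := by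
        simp [z, Matrix.smul_one_eq_diagonal]
      have hzu : ∀ u : Fin 2 → ℝ, z • u = a ^ 2 • u := by
        intro u
        rw [gl_smul_eq, hz, Matrix.smul_mulVec, Matrix.one_mulVec]
      have : g * g = z := by
        refine gl_ext_of_smul hvw ?_ ?_
        · rw [hzu, mul_smul, hva, gl_smul_smul, hva, smul_smul, sq]
        · rw [hzu, mul_smul, hwb, gl_smul_smul, hwb, smul_smul, ← sq, hsq]
      rw [← hz, ← this, Units.val_mul]

theorem isCompact_orthogonalGroup :
    IsCompact (Matrix.orthogonalGroup (Fin 2) ℝ : Set (Matrix (Fin 2) (Fin 2) ℝ)) := by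
  have hb : IsCompact (Set.pi Set.univ fun _ : Fin 2 => Set.pi Set.univ fun _ : Fin 2 =>
      Set.Icc (-1 : ℝ) 1) := isCompact_univ_pi fun _ => isCompact_univ_pi fun _ => isCompact_Icc
  refine hb.of_isClosed_subset ?_ ?_
  · have : (Matrix.orthogonalGroup (Fin 2) ℝ : Set (Matrix (Fin 2) (Fin 2) ℝ)) =
        {X | star X * X = 1} := by
      ext X
      exact Matrix.mem_orthogonalGroup_iff' _ _
    rw [this]
    exact isClosed_eq (by fun_prop) continuous_const
  · intro X hX i _ j _
    have := entry_norm_bound_of_unitary hX i j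
    rwa [Real.norm_eq_abs, abs_le] at this

instance : CompactSpace (Matrix.orthogonalGroup (Fin 2) ℝ) :=
  isCompact_iff_compactSpace.1 isCompact_orthogonalGroup

theorem smul_rp1_eq_of_val_eq_smul {g h : GL (Fin 2) ℝ} {c : ℝ}
    (hgh : (g : Matrix (Fin 2) (Fin 2) ℝ) = c • (h : Matrix (Fin 2) (Fin 2) ℝ)) (x : RP1) :
    g • x = h • x := by
  obtain ⟨v, hv, rfl⟩ := exists_eq_mk x
  rw [smul_mk, smul_mk, mk_eq_mk_iff']
  refine ⟨c, ?_⟩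
  rw [gl_smul_eq, gl_smul_eq, hgh, Matrix.smul_mulVec]

/-- By recurrence, a conformal matrix mapping a closed set into itself maps it onto itself. -/
theorem IsConformal.smul_eq {g : GL (Fin 2) ℝ} (hg : IsConformal g) {C : Set RP1}
    (hC : IsClosed C) (hgC : g • C ⊆ C) : g • C = C := by
  obtain ⟨M, hM⟩ := hg
  set Q : Matrix.orthogonalGroup (Fin 2) ℝ := ⟨normalized (M * g * M⁻¹), hM⟩
  set φ : Matrix.orthogonalGroup (Fin 2) ℝ →* GL (Fin 2) ℝ := Unitary.toUnits
  have hφ : Continuous φ := by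
    refine Units.continuous_iff.2 ⟨continuous_subtype_val, ?_⟩
    exact continuous_subtype_val.comp (continuous_star.comp continuous_id)
  have hQ : MulAction.toPermHom (GL (Fin 2) ℝ) RP1 (φ Q) =
      MulAction.toPermHom (GL (Fin 2) ℝ) RP1 (M * g * M⁻¹) := by
    ext x : 1
    exact smul_rp1_eq_of_val_eq_smul rfl x
  have hpow : ∀ (n : ℤ) (x : RP1), M⁻¹ • φ (Q ^ n) • M • x = g ^ n • x := by
    intro n x
    have h : φ (Q ^ n) • M • x = (M * g * M⁻¹) ^ n • M • x := by
      have := congrArg (fun e => (e ^ n) (M • x)) hQ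
      simp only [← map_zpow] at this
      exact this
    rw [h, conj_zpow, ← mul_smul, ← mul_smul]
    congr 1
    group
  have hn : ∀ n : ℕ, ∀ x ∈ C, g ^ n • x ∈ C := by
    intro n x hx
    induction n with
    | zero => simpa using hx
    | succ n ih =>
      rw [pow_succ', mul_smul]
      exact hgC (Set.smul_mem_smul_set ih)
  refine hgC.antisymm fun x hx => ?_
  rw [Set.mem_smul_set_iff_inv_smul_mem]
  have hcont : Continuous fun U : Matrix.orthogonalGroup (Fin 2) ℝ => M⁻¹ • φ U • M • x :=
    (continuous_const_smul M⁻¹).comp (hφ.smul (continuous_const (y := M • x)))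
  -- In a compact group the inverse is a cluster point of the positive powers, which all keep `x` in
  -- the closed set `C`.
  have hmem : Q⁻¹ ∈ closure (Set.range (Q ^ · : ℕ → Matrix.orthogonalGroup (Fin 2) ℝ)) :=
    ((mapClusterPt_atTop_pow_tfae Q⁻¹ Q).out 0 2).1
      (mapClusterPt_inv_atTop_pow.2 (mapClusterPt_self_atTop_pow Q))
  have hsub := closure_minimal
    (s := Set.range (Q ^ · : ℕ → Matrix.orthogonalGroup (Fin 2) ℝ))
    (t := (fun U => M⁻¹ • φ U • M • x) ⁻¹' C) (by
    rintro _ ⟨n, rfl⟩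
    have := hpow n x
    rw [zpow_natCast, zpow_natCast] at this
    change M⁻¹ • φ (Q ^ n) • M • x ∈ C
    rw [this]
    exact hn n x hx) (hC.preimage hcont)
  have := hsub hmem
  change M⁻¹ • φ Q⁻¹ • M • x ∈ C at this
  rwa [← zpow_neg_one Q, hpow, zpow_neg_one] at this

end Conformal

/-! ### From iterates to a one-step strongly invariant set -/

section Iterate

variable {C : Set RP1} {B : Set (GL (Fin 2) ℝ)}

/-- The images of `C` under all products of `n` elements of `B`. -/
def imageIterate (B : Set (GL (Fin 2) ℝ)) (C : Set RP1) (n : ℕ) : Set RP1 :=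
  (fun D => B • D)^[n] C

theorem imageIterate_succ (n : ℕ) : imageIterate B C (n + 1) = B • imageIterate B C n :=
  Function.iterate_succ_apply' _ _ _

theorem imageIterate_antitone (hB : B • C ⊆ C) : Antitone (imageIterate B C) := by
  refine antitone_nat_of_succ_le fun n => ?_
  induction n with
  | zero => exact hB
  | succ n ih =>
    rw [imageIterate_succ (n + 1)]
    nth_rw 2 [imageIterate_succ n]
    exact Set.smul_subset_smul_left ih

theorem isCompact_imageIterate (hB : IsCompact B) (hC : IsCompact C) (n : ℕ) :
    IsCompact (imageIterate B C n) := by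
  induction n with
  | zero => exact hC
  | succ n ih =>
    rw [imageIterate_succ]
    exact hB.smul_set ih

/-- A neighbourhood of `D` which `B` maps into a given neighbourhood of `B • D`. -/
theorem exists_isIntervalUnion_smul_subset {D U V : Set RP1} (hB : IsCompact B) (hD : IsCompact D)
    (hU : IsOpen U) (hDU : D ⊆ U) (hV : IsOpen V) (hBD : B • D ⊆ V) :
    ∃ N, IsIntervalUnion N ∧ D ⊆ interior N ∧ N ⊆ U ∧ B • N ⊆ V := by
  obtain ⟨u, v, -, hv, hBu, hDv, huv⟩ := generalized_tube_lemma hB hD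
    (hV.preimage (continuous_smul (M := GL (Fin 2) ℝ) (X := RP1)))
    (fun p hp => hBD (Set.smul_mem_smul hp.1 hp.2))
  obtain ⟨N, h1, h2, h3⟩ := exists_isIntervalUnion_between hD (hU.inter hv)
    (Set.subset_inter hDU hDv)
  refine ⟨N, h1, h2, fun x hx => (h3 hx).1, ?_⟩
  rintro _ ⟨b, hb, x, hx, rfl⟩
  exact huv (a := (b, x)) ⟨hBu hb, (h3 hx).2⟩

/-- If some iterate of `B` maps `C` into its interior, then `B` maps a neighbourhood of `C` into
its interior. -/
theorem exists_strongly_invariant {U : Set RP1} (hB : IsCompact B) (hC : IsCompact C)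
    (hBC : B • C ⊆ C) (hU : IsOpen U) (hCU : C ⊆ U) {m : ℕ}
    (hm : imageIterate B C m ⊆ interior C) :
    ∃ N, IsIntervalUnion N ∧ C ⊆ interior N ∧ N ⊆ U ∧ B • N ⊆ interior N := by
  have hanti := imageIterate_antitone hBC
  -- Descending induction on the iterate: a neighbourhood of the `j`-th iterate is added to `N`,
  -- small enough for `B` to send it into the interiors already reached. It starts from `N = ∅` once
  -- the iterate lies in `interior C`. At `j = 0` the interior of `N` contains `C` and absorbs
  -- `interior C`.
  have step : ∀ j, (∃ N, IsIntervalUnion N ∧ N ⊆ U ∧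
      imageIterate B C (j + 1) ⊆ interior N ∪ interior C ∧
      B • N ⊆ interior N ∪ interior C) →
      ∃ N, IsIntervalUnion N ∧ N ⊆ U ∧ imageIterate B C j ⊆ interior N ∧
        B • N ⊆ interior N ∪ interior C := by
    rintro j ⟨N, hN, hNU, hjN, hBN⟩
    rw [imageIterate_succ] at hjN
    obtain ⟨N', h1, h2, h3, h4⟩ := exists_isIntervalUnion_smul_subset hB
      (isCompact_imageIterate hB hC j) hU ((hanti (Nat.zero_le j)).trans hCU)
      (isOpen_interior.union isOpen_interior) hjN
    have hsub : interior N ∪ interior C ⊆ interior (N ∪ N') ∪ interior C :=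
      Set.union_subset_union_left _ (interior_mono Set.subset_union_left)
    refine ⟨N ∪ N', hN.union h1, Set.union_subset hNU h3,
      h2.trans (interior_mono Set.subset_union_right), ?_⟩
    rw [Set.smul_union]
    exact Set.union_subset (hBN.trans hsub) (h4.trans hsub)
  have main : ∀ n j, imageIterate B C (n + j) ⊆ interior C →
      ∃ N, IsIntervalUnion N ∧ N ⊆ U ∧ imageIterate B C j ⊆ interior N ∪ interior C ∧
        B • N ⊆ interior N ∪ interior C := by
    intro n
    induction n with
    | zero =>
      intro j hj
      rw [zero_add] at hj
      exact ⟨∅, isIntervalUnion_empty, Set.empty_subset _, hj.trans Set.subset_union_right,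
        by simp⟩
    | succ n ih =>
      intro j hj
      obtain ⟨N, h1, h2, h3, h4⟩ := step j (ih (j + 1) (by rwa [add_right_comm, add_assoc] at hj))
      exact ⟨N, h1, h2, h3.trans Set.subset_union_left, h4⟩
  obtain ⟨N, h1, h2, h3, h4⟩ := step 0 (main m 1 ((hanti (Nat.le_succ m)).trans hm))
  have h3 : C ⊆ interior N := h3
  exact ⟨N, h1, h3, h2, h4.trans (Set.union_subset subset_rfl (interior_subset.trans h3))⟩

end Iterate

/-! ### Long products leave the frontier -/

section Strict

variable {C : Set RP1} {T : Submonoid (GL (Fin 2) ℝ)}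

theorem smul_ne_of_left {s t : GL (Fin 2) ℝ} (hs : s • C ⊆ C) (ht : t • C ⊆ C) (h : s • C ≠ C) :
    (s * t) • C ≠ C := by
  intro hst
  refine h (hs.antisymm ?_)
  rw [mul_smul] at hst
  calc C = s • t • C := hst.symm
    _ ⊆ s • C := Set.smul_set_mono ht

theorem smul_interior_subset {t : GL (Fin 2) ℝ} (ht : t • C ⊆ C) :
    t • interior C ⊆ interior C := by
  rw [← interior_smul]
  exact interior_mono ht

/-- Sufficiently long products of elements which do not map `C` onto itself map `C` into its
interior. -/
theorem exists_imageIterate_subset_interior (hC : IsMulticone C) (hT : ∀ t ∈ T, IsTame C t)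
    {B : Set (GL (Fin 2) ℝ)} (hBT : ∀ b ∈ B, b ∈ T ∧ b • C ≠ C) :
    ∃ m, imageIterate B C m ⊆ interior C := by
  have hcl : IsClosed C := IsIntervalUnion.isClosed hC.1
  have hfin := IsIntervalUnion.frontier_finite hC.1
  have hBC : B • C ⊆ C := by
    rintro _ ⟨b, hb, x, hx, rfl⟩
    exact (hT b (hBT b hb).1).smul_subset (Set.smul_mem_smul_set hx)
  have hanti := imageIterate_antitone hBC
  set F : ℕ → Set RP1 := fun n => imageIterate B C n ∩ frontier C with hF
  have hFfin : ∀ n, (F n).Finite := fun n => hfin.subset Set.inter_subset_right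
  by_contra! hcon
  have hne : ∀ n, (F n).Nonempty := by
    intro n
    obtain ⟨x, hx, hxi⟩ := Set.not_subset.1 (hcon n)
    refine ⟨x, hx, ?_⟩
    rw [hcl.frontier_eq]
    exact ⟨hanti (Nat.zero_le n) hx, hxi⟩
  -- If two successive sets coincided, every point of `F n` would have a preimage in `F n` under
  -- some element of `B`.
  have hlt : ∀ n, (F (n + 1)).ncard < (F n).ncard := by
    intro n
    have hsub : F (n + 1) ⊆ F n := Set.inter_subset_inter_left _ (hanti (Nat.le_succ n))
    refine Set.ncard_lt_ncard (hsub.ssubset_of_ne fun heq => ?_) (hFfin n)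
    have hpre : ∀ x ∈ F n, ∃ y ∈ F n, ∃ b ∈ B, b • y = x := by
      intro x hx
      rw [← heq] at hx
      obtain ⟨hx1, hx2⟩ := hx
      rw [imageIterate_succ] at hx1
      obtain ⟨b, hb, y, hy, rfl⟩ := hx1
      refine ⟨y, ⟨hy, ?_⟩, b, hb, rfl⟩
      rw [hcl.frontier_eq] at hx2 ⊢
      refine ⟨hanti (Nat.zero_le n) hy, fun hyi => hx2.2 ?_⟩
      exact smul_interior_subset (hT b (hBT b hb).1).smul_subset (Set.smul_mem_smul_set hyi)
    have : Finite (F n) := hFfin n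
    -- Products make `r` transitive, and a tame matrix fixing a frontier point preserves `C`, so `r`
    -- is irreflexive. On a finite set it has a minimal element, which contradicts the existence of
    -- preimages.
    let r : F n → F n → Prop := fun y x => ∃ t ∈ T, t • C ≠ C ∧ t • (y : RP1) = x
    have : IsTrans (F n) r := ⟨by
      rintro x y z ⟨s, hs, hsC, hxy⟩ ⟨t, ht, htC, hyz⟩
      refine ⟨t * s, T.mul_mem ht hs,
        smul_ne_of_left (hT t ht).smul_subset (hT s hs).smul_subset htC, ?_⟩
      rw [mul_smul, hxy, hyz]⟩
    have : Std.Irrefl r := ⟨by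
      rintro x ⟨t, ht, htC, htx⟩
      exact htC ((hT t ht).smul_eq hcl x.2.2 htx)⟩
    have hwf : WellFounded r := Finite.wellFounded_of_trans_of_irrefl r
    obtain ⟨x0, hx0⟩ := hne n
    obtain ⟨x, -, hx⟩ := hwf.has_min Set.univ ⟨⟨x0, hx0⟩, trivial⟩
    obtain ⟨y, hy, b, hb, hbx⟩ := hpre x x.2
    exact hx ⟨y, hy⟩ trivial ⟨b, (hBT b hb).1, (hBT b hb).2, hbx⟩
  exact not_strictAnti_of_wellFoundedLT (fun n => (F n).ncard) (strictAnti_nat_of_succ_lt hlt)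

end Strict

/-! ### Construction of the strongly invariant multicone -/

/-- A compact set of elements of `T`, none of which maps `C` onto itself, has a strongly invariant
multicone which is fixed by all elements of the stabilizer group of `C`. -/
theorem exists_stronglyInvariant_of_isCompact {C : Set RP1} {T : Submonoid (GL (Fin 2) ℝ)}
    (hC : IsMulticone C) (hT : ∀ t ∈ T, IsTame C t) {B : Set (GL (Fin 2) ℝ)} (hB : IsCompact B)
    (hBT : ∀ b ∈ B, b ∈ T ∧ b • C ≠ C) :
    ∃ D, IsStronglyInvariantMulticone B D ∧ ∀ g ∈ stabilizerGroup hC hT, g • D = D := by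
  set G := stabilizerGroup hC hT
  have hGfin : (G : Set (GL (Fin 2) ℝ)).Finite := stabilizerGroup_finite hC hT
  have hGC : ∀ g ∈ G, g • C = C := fun g hg => hg.2.1
  have hcl : IsClosed C := IsIntervalUnion.isClosed hC.1
  -- Absorbing `G` on the right lets the final set be a union of translates `g • N`, because `b • g
  -- • N ⊆ B' • N`.
  set B' : Set (GL (Fin 2) ℝ) := B * (G : Set (GL (Fin 2) ℝ))
  have hB' : IsCompact B' := hB.mul hGfin.isCompact
  have hBT' : ∀ b ∈ B', b ∈ T ∧ b • C ≠ C := by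
    rintro _ ⟨b, hb, g, hg, rfl⟩
    exact ⟨T.mul_mem (hBT b hb).1 hg.1, smul_ne_of_left (hT b (hBT b hb).1).smul_subset
      (hGC g hg).subset (hBT b hb).2⟩
  have hBC : B' • C ⊆ C := by
    rintro _ ⟨b, hb, x, hx, rfl⟩
    exact (hT b (hBT' b hb).1).smul_subset (Set.smul_mem_smul_set hx)
  obtain ⟨m, hm⟩ := exists_imageIterate_subset_interior hC hT hBT'
  obtain ⟨x₀, hx₀⟩ := Set.nonempty_compl.2 hC.2.2
  -- Keeping `N` away from the whole orbit of a point outside `C` ensures that the translates of `N`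
  -- do not cover the projective line.
  set O : Set RP1 := (fun g : GL (Fin 2) ℝ => g • x₀) '' (G : Set (GL (Fin 2) ℝ))
  have hOinv : ∀ g ∈ G, ∀ x, g • x ∈ O → x ∈ O := by
    rintro g hg x ⟨h, hh, hx⟩
    refine ⟨g⁻¹ * h, G.mul_mem (G.inv_mem hg) hh, ?_⟩
    have hx : h • x₀ = g • x := hx
    change (g⁻¹ * h) • x₀ = x
    rw [mul_smul, hx, inv_smul_smul]
  have hCO : C ⊆ Oᶜ := by
    rintro _ hx ⟨g, hg, rfl⟩
    apply hx₀
    have hx : g • x₀ ∈ C := hx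
    rw [← hGC g hg] at hx
    exact (Set.smul_mem_smul_set_iff).1 hx
  obtain ⟨N, hN, hCN, hNO, hBN⟩ := exists_strongly_invariant hB' hcl.isCompact hBC
    (hGfin.image _).isClosed.isOpen_compl hCO hm
  set D : Set RP1 := ⋃ g ∈ (G : Set (GL (Fin 2) ℝ)), g • N
  have hND : N ⊆ D := by
    intro x hx
    refine Set.mem_biUnion G.one_mem ?_
    rwa [one_smul]
  have hGD : ∀ g ∈ G, g • D ⊆ D := by
    rintro g hg _ ⟨x, hx, rfl⟩
    obtain ⟨h, hh, y, hy, rfl⟩ := Set.mem_iUnion₂.1 hx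
    refine Set.mem_biUnion (G.mul_mem hg hh) ?_
    refine ⟨y, hy, ?_⟩
    change (g * h) • y = g • h • y
    rw [mul_smul]
  refine ⟨D, ⟨⟨isIntervalUnion_biUnion hGfin fun g _ => hN.smul g, ?_, ?_⟩, ?_⟩, ?_⟩
  · exact hC.2.1.mono (hCN.trans (interior_subset.trans hND))
  · intro hD
    have hx : x₀ ∈ D := hD ▸ Set.mem_univ x₀
    obtain ⟨g, hg, y, hy, hgy⟩ := Set.mem_iUnion₂.1 hx
    have hgy : g • y = x₀ := hgy
    exact hNO hy (hOinv g hg y ⟨1, G.one_mem, by rw [hgy]; exact one_smul _ _⟩)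
  · rintro b hb _ ⟨x, hx, rfl⟩
    obtain ⟨g, hg, y, hy, rfl⟩ := Set.mem_iUnion₂.1 hx
    refine interior_mono hND (hBN ⟨b * g, Set.mul_mem_mul hb hg, y, hy, ?_⟩)
    exact mul_smul b g y
  · intro g hg
    refine (hGD g hg).antisymm ?_
    rw [Set.subset_smul_set_iff]
    exact hGD g⁻¹ (G.inv_mem hg)

/-! ### Scaling and normalization -/

section Scaling

variable {C : Set RP1} {s t : GL (Fin 2) ℝ} {c : ℝ}

theorem scale_ne_zero
    (h : (t : Matrix (Fin 2) (Fin 2) ℝ) = c • (s : Matrix (Fin 2) (Fin 2) ℝ)) : c ≠ 0 := by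
  rintro rfl
  apply det_gl_ne_zero t
  rw [h, zero_smul, Matrix.det_zero]

/-- A scalar factor acts trivially on lines and multiplies all eigenvalues by the same nonzero
number. This allows normalization of the determinant, which may leave the semigroup. -/
theorem IsTame.of_val_eq_smul (hs : IsTame C s)
    (h : (t : Matrix (Fin 2) (Fin 2) ℝ) = c • (s : Matrix (Fin 2) (Fin 2) ℝ)) : IsTame C t := by
  have hc := scale_ne_zero h
  have hv : ∀ v : Fin 2 → ℝ, t • v = c • s • v := fun v => by
    rw [gl_smul_eq, gl_smul_eq, h, Matrix.smul_mulVec]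
  have heig : ∀ (v : Fin 2 → ℝ) (a : ℝ), t • v = a • v → s • v = (c⁻¹ * a) • v := by
    intro v a hva
    rw [mul_smul, ← hva, hv, inv_smul_smul₀ hc]
  refine ⟨?_, ?_, ?_⟩
  · rintro _ ⟨x, hx, rfl⟩
    change t • x ∈ C
    rw [smul_rp1_eq_of_val_eq_smul h]
    exact hs.smul_subset (Set.smul_mem_smul_set hx)
  · intro v a hv0 hva
    obtain ⟨w, b, hvw, hwb⟩ := hs.exists_eigen v _ hv0 (heig v a hva)
    exact ⟨w, c * b, hvw, by rw [hv, hwb, mul_smul]⟩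
  · intro v w a b hv0 hw0 hva hwb hab
    refine hs.directions v w _ _ hv0 hw0 (heig v a hva) (heig w b hwb) ?_
    rw [abs_mul, abs_mul]
    exact mul_lt_mul_of_pos_left hab (abs_pos.2 (inv_ne_zero hc))

theorem isTame_one : IsTame C 1 := by
  refine ⟨(one_smul _ C).subset, ?_, ?_⟩
  · intro v a hv hva
    -- The quarter turn of `v` is independent of it.
    refine ⟨![-v 1, v 0], 1, fun h => hv ?_, by rw [one_smul, one_smul]⟩
    have h : v 0 * v 0 - v 1 * -v 1 = 0 := h
    have h0 : v 0 = 0 := by nlinarith [mul_self_nonneg (v 0), mul_self_nonneg (v 1)]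
    have h1 : v 1 = 0 := by nlinarith [mul_self_nonneg (v 0), mul_self_nonneg (v 1)]
    ext i
    fin_cases i
    · exact h0
    · exact h1
  · intro v w a b hv hw hva hwb hab
    have key : ∀ (v : Fin 2 → ℝ) (a : ℝ), v ≠ 0 → (1 : GL (Fin 2) ℝ) • v = a • v → a = 1 := by
      intro v a hv h
      rw [one_smul] at h
      exact (smul_left_injective ℝ hv (by simpa using h)).symm
    rw [key v a hv hva, key w b hw hwb] at hab
    exact absurd hab (lt_irrefl _)

theorem normalized_eq_of_val_eq_smul (hc : 0 < c)
    (h : (t : Matrix (Fin 2) (Fin 2) ℝ) = c • (s : Matrix (Fin 2) (Fin 2) ℝ)) :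
    normalized t = normalized s := by
  have hd := abs_det_pos s
  rw [normalized, normalized, h, Matrix.det_smul, smul_smul, Fintype.card_fin, abs_mul,
    abs_of_pos (pow_pos hc 2), Real.mul_rpow (by positivity) hd.le, ← Real.rpow_natCast,
    ← Real.rpow_mul hc.le]
  congr 1
  norm_num
  rw [Real.rpow_neg_one]
  field_simp

theorem IsConformalWith.of_val_eq_smul {M : GL (Fin 2) ℝ} (ht : IsConformalWith M t) (hc : 0 < c)
    (h : (t : Matrix (Fin 2) (Fin 2) ℝ) = c • (s : Matrix (Fin 2) (Fin 2) ℝ)) :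
    IsConformalWith M s := by
  rw [IsConformalWith, ← normalized_eq_of_val_eq_smul (t := M * t * M⁻¹) hc]
  · exact ht
  · simp only [Units.val_mul, h, Matrix.mul_smul, Matrix.smul_mul]

theorem exists_gl_val_eq_normalized (g : GL (Fin 2) ℝ) : ∃ (n : GL (Fin 2) ℝ) (c : ℝ), 0 < c ∧
    (n : Matrix (Fin 2) (Fin 2) ℝ) = normalized g ∧
    (n : Matrix (Fin 2) (Fin 2) ℝ) = c • (g : Matrix (Fin 2) (Fin 2) ℝ) ∧
    |(n : Matrix (Fin 2) (Fin 2) ℝ).det| = 1 := by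
  have hd := abs_det_pos g
  have hc := Real.rpow_pos_of_pos hd (-(1 / 2) : ℝ)
  have hdet : |(normalized g).det| = 1 := by
    rw [normalized, Matrix.det_smul, Fintype.card_fin, abs_mul, abs_of_pos (pow_pos hc 2),
      ← Real.rpow_natCast, ← Real.rpow_mul hd.le]
    norm_num
    rw [Real.rpow_neg_one]
    exact inv_mul_cancel₀ hd.ne'
  refine ⟨Matrix.GeneralLinearGroup.mkOfDetNeZero (normalized g) ?_, _, hc, rfl, rfl, hdet⟩
  intro h
  rw [h, abs_zero] at hdet
  exact zero_ne_one hdet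

end Scaling

/-- The monoid of all nonzero multiples of the identity and of the elements of the semigroup
generated by `A`. -/
def scaledMonoid (A : Set (GL (Fin 2) ℝ)) : Submonoid (GL (Fin 2) ℝ) where
  carrier := {t | ∃ (c : ℝ) (s : GL (Fin 2) ℝ), (s ∈ semigroup A ∨ s = 1) ∧
    (t : Matrix (Fin 2) (Fin 2) ℝ) = c • (s : Matrix (Fin 2) (Fin 2) ℝ)}
  one_mem' := ⟨1, 1, Or.inr rfl, (one_smul _ _).symm⟩
  mul_mem' := by
    rintro t t' ⟨c, s, hs, h⟩ ⟨c', s', hs', h'⟩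
    refine ⟨c * c', s * s', ?_, ?_⟩
    · rcases hs with hs | rfl
      · rcases hs' with hs' | rfl
        · exact Or.inl (mul_mem hs hs')
        · exact Or.inl (by rwa [mul_one])
      · rwa [one_mul]
    · rw [Units.val_mul, h, h', smul_mul_smul_comm, Units.val_mul]

theorem isTame_of_mem_semigroup {A : Set (GL (Fin 2) ℝ)} {C : Set RP1}
    (hinv : IsInvariantMulticone A C) (hunst : IsUnstableMulticone A C)
    (hpar : ∀ g ∈ semigroup A, ¬ IsParabolic g) {s : GL (Fin 2) ℝ} (hs : s ∈ semigroup A) :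
    IsTame C s := by
  refine ⟨?_, fun v a hv hva => exists_eigen_of_not_isParabolic (hpar s hs) hv hva, ?_⟩
  · induction hs using Subsemigroup.closure_induction with
    | mem g hg => exact hinv.2 g hg
    | mul g h _ _ ihg ihh =>
      rw [mul_smul]
      exact (Set.smul_set_mono ihh).trans ihg
  · intro v w a b hv hw hva hwb hab
    obtain ⟨hp, hu, hst⟩ := directions_of_eigen hv hw hva hwb hab
    obtain ⟨-, -, h1, h2, -⟩ := hunst
    constructor
    · intro h
      exact (Set.eq_empty_iff_forall_notMem.1 h2) _ ⟨h, subset_closure ⟨s, hs, hp, hu⟩⟩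
    · intro h
      exact (Set.eq_empty_iff_forall_notMem.1 h1) _ ⟨h, subset_closure ⟨s, hs, hp, hst⟩⟩

end PlanarMatrix

end

/-! ### The proposition -/

open PlanarMatrix
theorem proposition2p2 (A : Set (GL (Fin 2) ℝ))
    (hC : ∃ C : Set RP1, IsInvariantMulticone A C ∧ IsUnstableMulticone A C)
    (hpar : ∀ g ∈ semigroup A, ¬ IsParabolic g) :
    ((A \ conformalPart A).Nonempty ∧ ∀ g ∈ A \ conformalPart A, IsProximal g) ∧
    (IsStronglyConformal (conformalPart A) ∧
      (Subsemigroup.closure (normalized '' conformalPart A) :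
        Set (Matrix (Fin 2) (Fin 2) ℝ)).Finite) ∧
    (IsCompact (A \ conformalPart A) →
      ∃ C : Set RP1, IsStronglyInvariantMulticone (A \ conformalPart A) C ∧
        ∀ g ∈ conformalPart A, g • C = C) := by
  obtain ⟨C, hinv, hunst⟩ := hC
  have hCm : IsMulticone C := hinv.1
  have hcl : IsClosed C := IsIntervalUnion.isClosed hCm.1
  have hS : ∀ s ∈ semigroup A, IsTame C s := fun s hs =>
    isTame_of_mem_semigroup hinv hunst hpar hs
  have hT : ∀ t ∈ scaledMonoid A, IsTame C t := by
    rintro t ⟨c, s, hs | rfl, h⟩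
    · exact (hS s hs).of_val_eq_smul h
    · exact isTame_one.of_val_eq_smul h
  have hAS : ∀ g ∈ A, g ∈ semigroup A := fun g hg => Subsemigroup.subset_closure hg
  have hAT : ∀ g ∈ A, g ∈ scaledMonoid A := fun g hg =>
    ⟨1, g, Or.inl (hAS g hg), (one_smul _ _).symm⟩
  set G := stabilizerGroup hCm hT with hG
  have hGfin : (G : Set (GL (Fin 2) ℝ)).Finite := stabilizerGroup_finite hCm hT
  obtain ⟨M, hM⟩ := isStronglyConformal_of_finite G hGfin fun g hg => hg.2.2
  have hnorm : ∀ g ∈ A, g • C = C → ∃ n ∈ G, ∃ c : ℝ, 0 < c ∧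
      (n : Matrix (Fin 2) (Fin 2) ℝ) = normalized g ∧
      (n : Matrix (Fin 2) (Fin 2) ℝ) = c • (g : Matrix (Fin 2) (Fin 2) ℝ) := by
    intro g hg hgC
    obtain ⟨n, c, hc, h1, h2, h3⟩ := exists_gl_val_eq_normalized g
    refine ⟨n, ⟨⟨c, g, Or.inl (hAS g hg), h2⟩, ?_, h3⟩, c, hc, h1, h2⟩
    exact (Set.image_congr fun x _ => smul_rp1_eq_of_val_eq_smul h2 x).trans hgC
  have hconf : ∀ g ∈ conformalPart A, g • C = C := fun g hg =>
    hg.2.smul_eq hcl (hinv.2 g hg.1)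
  -- An element of `A` preserving `C` normalizes into the finite group `G`, hence is conformal with
  -- the common matrix `M`.
  have hnonconf : ∀ g ∈ A \ conformalPart A, g • C ≠ C := by
    intro g hg hgC
    obtain ⟨n, hn, c, hc, -, h⟩ := hnorm g hg.1 hgC
    exact hg.2 ⟨hg.1, M, (hM n hn).of_val_eq_smul hc h⟩
  refine ⟨⟨?_, ?_⟩, ⟨⟨M, ?_⟩, ?_⟩, ?_⟩
  -- If all elements of `A` were conformal, every product would map `C` onto itself, including the
  -- proximal one.
  · by_contra hempty
    rw [Set.not_nonempty_iff_eq_empty, Set.sdiff_eq_empty] at hempty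
    obtain ⟨s, hs, hprox⟩ := hunst.2.1
    obtain ⟨v, w, a, b, hv, hw, hva, hwb, hab⟩ := hprox.exists_eigen
    refine (hS s hs).smul_ne_of_proximal hcl (hCm.frontier_nontrivial.mono hcl.frontier_subset)
      hv hw hva hwb hab ?_
    clear hprox hva hwb
    induction hs using Subsemigroup.closure_induction with
    | mem g hg => exact hconf g (hempty hg)
    | mul g h _ _ ihg ihh => rw [mul_smul, ihh, ihg]
  · intro g hg
    by_contra hprox
    exact hg.2 ⟨hg.1, isConformal_of_not_isProximal hprox (hpar g (hAS g hg.1))⟩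
  · intro g hg
    obtain ⟨n, hn, c, hc, -, h⟩ := hnorm g hg.1 (hconf g hg)
    exact (hM n hn).of_val_eq_smul hc h
  · refine (hGfin.image Units.val).subset ?_
    have : Subsemigroup.closure (normalized '' conformalPart A) ≤
        (G.toSubmonoid.map (Units.coeHom (Matrix (Fin 2) (Fin 2) ℝ))).toSubsemigroup := by
      rw [Subsemigroup.closure_le]
      rintro _ ⟨g, hg, rfl⟩
      obtain ⟨n, hn, c, hc, h, -⟩ := hnorm g hg.1 (hconf g hg)
      exact ⟨n, hn, h⟩
    exact this
  · intro hcomp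
    obtain ⟨D, hD, hGD⟩ := exists_stronglyInvariant_of_isCompact hCm hT hcomp
      fun g hg => ⟨hAT g hg.1, hnonconf g hg⟩
    refine ⟨D, hD, fun g hg => ?_⟩
    obtain ⟨n, hn, c, hc, -, h⟩ := hnorm g hg.1 (hconf g hg)
    exact (Set.image_congr fun x _ => (smul_rp1_eq_of_val_eq_smul h x).symm).trans (hGD n hn)
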